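/- **Model.** An instance $\omega$ of multiprocessor multitask scheduling on $N$ identical machines is a finite nonempty set of jobs; job $i$ has a release date $r_i\ge 0$ and finitely many (at least one) tasks with processing times $p_{i,\ell}>0$, each of which is either preemptive or non-preemptive; its workload is $p_i=\sum_\ell p_{i,\ell}$. At each time a machine processes at most one task and a task is processed by at most one machine; no task is processed before the release of its job; different tasks of a job may run in parallel; a preemptive task may be interrupted and resumed on any machine, while a non-preemptive task, once started, runs on its machine without interruption until it is completed. Job $i$ is completed at the time $C_i$ at which its last task is completed, and the cost of a schedule is the total response time $\sum_i (C_i-r_i)$. Let $\mathrm{OPT}(\omega)$ be the infimum of the cost over all feasible schedules. A (deterministic) online algorithm $\mathcal A$ produces a feasible schedule for every instance, where the decisions at time $t$ depend only on the jobs released up to time $t$; $\mathrm{Cost}_{\mathcal A}(\omega)$ is the cost of its schedule. Put $$\alpha(\omega)=\frac{\max_i p_i}{\min_i p_i},\qquad \beta(\omega)=\frac{\eta(\omega)}{\min_i p_i},$$ where $\eta(\omega)$ is the largest processing time of a non-preemptive task ($0$ if there is none). For a class $S$ of instances let $\mathcal{CR}_{\mathcal A}^{S}(\alpha,\beta)$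 be the supremum of $\mathrm{Cost}_{\mathcal A}(\omega)/\mathrm{OPT}(\omega)$ over the $\omega\in S$ with $\alpha(\omega)=\alpha$ and $\beta(\omega)=\beta$. We say that $\mathcal A$ has competitive ratio $o(g(\alpha,\beta))$ on $S$ if for every $\varepsilon>0$ there is an $M$ such that $\mathcal{CR}_{\mathcal A}^{S}(\alpha,\beta)\le\varepsilon\, g(\alpha,\beta)$ whenever $g(\alpha,\beta)\ge M$. **Proposition.** Fix the number $N\ge 1$ of machines. No online algorithm has competitive ratio $o(\ln\alpha+\beta)$ on the class of all instances. More precisely: 1. if $N\ge 2$, no online algorithm has competitive ratio $o(\ln\alpha)$ on the class of instances all of whose jobs consist of a single preemptive task (there $\beta=0$); 2. no online algorithm has competitive ratio $o(\beta)$ on the class of instances all of whose jobs consist of a single non-preemptive task (there $\beta=\alpha$). -/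

import Mathlib

namespace MPMS

/-- A task: its processing time and whether it is non-preemptive. -/
structure JobTask where
  size : ℝ
  size_pos : 0 < size
  nonpreemptive : Bool

/-- A job: its release date and its (nonempty) list of tasks. -/
structure Job where
  release : ℝ
  release_nonneg : 0 ≤ release
  tasks : List JobTask
  tasks_ne : tasks ≠ []

/-- The workload of a job: the sum of the processing times of its tasks. -/
noncomputable def Job.workload (J : Job) : ℝ := (J.tasks.map JobTask.size).sum

/-- An input instance: a finite nonempty list of jobs, numbered in the order of their release
(so that the number of a job reveals nothing about jobs that are released later). -/
structure Input where
  jobs : List Job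
  jobs_ne : jobs ≠ []
  sorted : jobs.Pairwise (fun J K => J.release ≤ K.release)

namespace Input

/-- Largest job workload (a maximum over a finite nonempty set). -/
noncomputable def pmax (ω : Input) : ℝ := sSup {x | ∃ J ∈ ω.jobs, x = J.workload}

/-- Smallest job workload (a minimum over a finite nonempty set). -/
noncomputable def pmin (ω : Input) : ℝ := sInf {x | ∃ J ∈ ω.jobs, x = J.workload}

/-- Largest processing time of a non-preemptive task; it is `0` if there is no such task
(`sSup ∅ = 0` in `ℝ`). -/
noncomputable def eta (ω : Input) : ℝ :=
  sSup {x | ∃ J ∈ ω.jobs, ∃ T ∈ J.tasks, T.nonpreemptive = true ∧ x = T.size}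

/-- Ratio of the largest to the smallest job workload. -/
noncomputable def alpha (ω : Input) : ℝ := ω.pmax / ω.pmin

/-- Ratio of the largest non-preemptive task to the smallest job workload. -/
noncomputable def beta (ω : Input) : ℝ := ω.eta / ω.pmin

/-- What is known at time `t`: the jobs released at or before `t`.  It is a prefix of the list
of jobs. -/
noncomputable def revealed (ω : Input) (t : ℝ) : List Job :=
  ω.jobs.filter (fun J => decide (J.release ≤ t))

end Input

/-- A schedule on `N` identical machines: which task, if any, each machine processes at each
time.  The pair `(i, l)` stands for the `l`-th task of the `i`-th job. -/
abbrev Schedule (N : ℕ) := Fin N → ℝ → Option (ℕ × ℕ)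

/-- The times at which the task `τ` is processed. -/
def Schedule.served {N : ℕ} (σ : Schedule N) (τ : ℕ × ℕ) : Set ℝ := {t | ∃ m, σ m t = some τ}

/-- The completion time of the task `τ` of processing time `p`: the first time by which it has
been processed for `p` units of time. -/
noncomputable def Schedule.completion {N : ℕ} (σ : Schedule N) (τ : ℕ × ℕ) (p : ℝ) : ℝ :=
  sInf {T | MeasureTheory.volume (σ.served τ ∩ Set.Iic T) = ENNReal.ofReal p}

/-- Feasible schedules.  Tasks of one job may run in parallel; preemptive tasks may be interrupted
and resumed on any machine; non-preemptive tasks run on one machine without interruption. -/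
structure Feasible {N : ℕ} (ω : Input) (σ : Schedule N) : Prop where
  /-- only existing tasks are processed, and none before the release of its job -/
  valid : ∀ m t i l, σ m t = some (i, l) →
    ∃ h : i < ω.jobs.length, l < ω.jobs[i].tasks.length ∧ ω.jobs[i].release ≤ t
  measurable : ∀ m τ, MeasurableSet {t | σ m t = some τ}
  /-- a task is processed by at most one machine at a time -/
  single : ∀ m m' t τ, σ m t = some τ → σ m' t = some τ → m = m'
  /-- every task is processed for exactly its processing time -/
  service : ∀ (i : Fin ω.jobs.length) (l : Fin ω.jobs[i].tasks.length),
    MeasureTheory.volume (σ.served (i, l)) = ENNReal.ofReal ω.jobs[i].tasks[l].size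
  /-- every task is completed at some finite time -/
  complete : ∀ (i : Fin ω.jobs.length) (l : Fin ω.jobs[i].tasks.length),
    ∃ T : ℝ, MeasureTheory.volume (σ.served (i, l) ∩ Set.Iic T)
      = ENNReal.ofReal ω.jobs[i].tasks[l].size
  /-- a non-preemptive task is run to completion once it has been started -/
  nonpreempt : ∀ (i : Fin ω.jobs.length) (l : Fin ω.jobs[i].tasks.length),
    ω.jobs[i].tasks[l].nonpreemptive = true →
      ∃ (m : Fin N) (s : ℝ), ∀ (m' : Fin N) (t : ℝ),
        σ m' t = some ((i : ℕ), (l : ℕ)) ↔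
          m' = m ∧ s ≤ t ∧ t < s + ω.jobs[i].tasks[l].size

/-- Completion time of a job: the maximum of the completion times of its tasks. -/
noncomputable def jobCompletion {N : ℕ} (ω : Input) (σ : Schedule N)
    (i : Fin ω.jobs.length) : ℝ :=
  ⨆ l : Fin ω.jobs[i].tasks.length, σ.completion (i, l) ω.jobs[i].tasks[l].size

/-- Total response time. -/
noncomputable def cost {N : ℕ} (ω : Input) (σ : Schedule N) : ℝ :=
  ∑ i : Fin ω.jobs.length, (jobCompletion ω σ i - ω.jobs[i].release)

/-- Optimal offline cost on `N` machines. -/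
noncomputable def opt (N : ℕ) (ω : Input) : ℝ :=
  sInf {c | ∃ σ : Schedule N, Feasible ω σ ∧ c = cost ω σ}

/-- A (deterministic) online algorithm on `N` machines: it produces a feasible schedule for every
instance, and what it does at time `t` depends only on the jobs released up to time `t`. -/
structure OnlineAlgorithm (N : ℕ) where
  run : Input → Schedule N
  feasible : ∀ ω, Feasible ω (run ω)
  causal : ∀ (ω ω' : Input) (t : ℝ), ω.revealed t = ω'.revealed t →
    ∀ m, run ω m t = run ω' m t

/-- Competitive ratio of an online algorithm over the class `S` of instances. -/
noncomputable def competitiveRatio {N : ℕ} (A : OnlineAlgorithm N) (S : Set Input) : ENNReal :=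
  ⨆ ω ∈ S, ENNReal.ofReal (cost ω (A.run ω) / opt N ω)

/-- On the class `S`, the competitive ratio of `A`, as a function of the parameters `(α, β)`, is
`o(g(α, β))` as `g(α, β) → ∞`. -/
def RatioLittleO {N : ℕ} (A : OnlineAlgorithm N) (S : Set Input) (g : ℝ → ℝ → ℝ) : Prop :=
  ∀ ε : ℝ, 0 < ε → ∃ M : ℝ, ∀ a b : ℝ, M ≤ g a b →
    competitiveRatio A {ω | ω ∈ S ∧ ω.alpha = a ∧ ω.beta = b} ≤ ENNReal.ofReal (ε * g a b)

/-- Instances in which every job is a single task, and all tasks are preemptive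
(`np = false`) or all tasks are non-preemptive (`np = true`). -/
def singleTask (np : Bool) : Set Input :=
  {ω | ∀ J ∈ ω.jobs, J.tasks.length = 1 ∧ ∀ T ∈ J.tasks, T.nonpreemptive = np}

end MPMS

/-! Both lower bounds rest on a burst: `N` unit jobs per unit of time, enough to occupy all `N`
machines. An algorithm that has fallen behind cannot catch up during the burst, whereas a good
offline schedule serves each burst job on arrival and delays at most one long job. The backlog is
measured by the fractional number of unfinished jobs, the sum of `1 - work / p`; its integral over
time is a lower bound for the total response time (`mul_le_cost`).

Non-preemptive case (`exists_nonpreemptive_hard`). A job of length `b = 2k + 2` is released at time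
0, and the algorithm starts it at some time `s`. A burst of length `k` begins at `s + 1`. One
machine is blocked throughout, so the backlog grows at rate at least 1 and the cost is at least of
order `k ^ 2`. Offline, the long job is run before the burst or after it, at a cost of order `k` for
fixed `N`. Since `ln α ≤ α = β` on these instances, the bound for `ln α + β` follows as well.

Preemptive case (`exists_preemptive_hard`). Phase `i < n` brings one long job of length `L_i = 2 n
s_i` and `N n` short jobs of length `s_i = 9 ^ (n - i)`, and it lasts `L_i`. The short jobs alone
fill all machines during exactly half of the phase. If at the midpoint of some phase the algorithm
still has short work `n s_i / 2` or more to do, a burst begins there: its backlog is at least `n /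
2`, while an offline schedule has only the current long job left. Otherwise in every phase the long
job has received at most `L_i / 4` by the midpoint; the time left in this phase and in all later
ones is at most `L_i / 2 + L_i / 8`, so at least an eighth of each of the `n` long jobs remains when
the burst begins after the last phase. Offline, one machine takes the long job of each phase and the
other `N - 1 ≥ 1` machines take its short jobs, so that nothing is left. The burst is made so long
that it dominates the offline cost; the ratio is of order `n`, and `ln α` lies between `n` and `10
n`. -/

open MeasureTheory Set
namespace MPMS

/-! ### Single-task instances cut out of job streams -/

/-- A sequence of single-task jobs: release dates and processing times. -/
structure JobStream where
  r : ℕ → ℝ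
  p : ℕ → ℝ
  r_nonneg : ∀ i, 0 ≤ r i
  p_pos : ∀ i, 0 < p i
  mono : Monotone r

namespace JobStream

/-- The `i`-th job of a stream. -/
def job (S : JobStream) (np : Bool) (i : ℕ) : Job where
  release := S.r i
  release_nonneg := S.r_nonneg i
  tasks := [⟨S.p i, S.p_pos i, np⟩]
  tasks_ne := by simp

/-- The instance that consists of the first `n` jobs of a stream. -/
def input (S : JobStream) (np : Bool) (n : ℕ) (hn : 0 < n) : Input where
  jobs := (List.range n).map (S.job np)
  jobs_ne := by simp; omega
  sorted := by
    rw [List.pairwise_map]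
    exact List.pairwise_lt_range.imp fun h => S.mono h.le

variable {S : JobStream} {np : Bool} {n : ℕ} {hn : 0 < n} {N : ℕ}

theorem input_length : (S.input np n hn).jobs.length = n := by simp [input]

theorem input_getElem (i : ℕ) (h : i < (S.input np n hn).jobs.length) :
    (S.input np n hn).jobs[i] = S.job np i := by simp [input]

theorem mem_input {J : Job} : J ∈ (S.input np n hn).jobs ↔ ∃ i < n, J = S.job np i := by
  simp [input, eq_comm]

theorem workload_job (i : ℕ) : (S.job np i).workload = S.p i := by
  simp [Job.workload, job]

theorem input_mem_singleTask : S.input np n hn ∈ singleTask np := by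
  intro J hJ
  obtain ⟨i, -, rfl⟩ := mem_input.1 hJ
  simp [job]

theorem pmax_input (k : ℕ) (hk : k < n) (h : ∀ i < n, S.p i ≤ S.p k) :
    (S.input np n hn).pmax = S.p k := by
  refine IsGreatest.csSup_eq ⟨⟨_, mem_input.2 ⟨k, hk, rfl⟩, (workload_job k).symm⟩, ?_⟩
  rintro x ⟨J, hJ, rfl⟩
  obtain ⟨i, hi, rfl⟩ := mem_input.1 hJ
  simpa [workload_job] using h i hi

theorem pmin_input (k : ℕ) (hk : k < n) (h : ∀ i < n, S.p k ≤ S.p i) :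
    (S.input np n hn).pmin = S.p k := by
  refine IsLeast.csInf_eq ⟨⟨_, mem_input.2 ⟨k, hk, rfl⟩, (workload_job k).symm⟩, ?_⟩
  rintro x ⟨J, hJ, rfl⟩
  obtain ⟨i, hi, rfl⟩ := mem_input.1 hJ
  simpa [workload_job] using h i hi

theorem eta_input (k : ℕ) (hk : k < n) (h : ∀ i < n, S.p i ≤ S.p k) :
    (S.input true n hn).eta = S.p k := by
  refine IsGreatest.csSup_eq ⟨⟨_, mem_input.2 ⟨k, hk, rfl⟩, ?_⟩, ?_⟩
  · simp [job]
  · rintro x ⟨J, hJ, T, hT, -, rfl⟩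
    obtain ⟨i, hi, rfl⟩ := mem_input.1 hJ
    simp only [job, List.mem_singleton] at hT
    subst hT
    exact h i hi

/-- The form in which causality is applied: beyond the common prefix, neither instance has released
anything by time `t`. -/
theorem revealed_input_eq {S' : JobStream} {n' : ℕ} {hn' : 0 < n'} (k : ℕ) (t : ℝ)
    (hk : k ≤ n) (hk' : k ≤ n') (hr : ∀ i < k, S.r i = S'.r i) (hp : ∀ i < k, S.p i = S'.p i)
    (h : ∀ i, k ≤ i → i < n → t < S.r i) (h' : ∀ i, k ≤ i → i < n' → t < S'.r i) :
    (S.input np n hn).revealed t = (S'.input np n' hn').revealed t := by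
  have key : ∀ (S : JobStream) (n : ℕ) (hn : 0 < n), k ≤ n → (∀ i, k ≤ i → i < n → t < S.r i) →
      (S.input np n hn).revealed t
        = ((List.range k).map (S.job np)).filter (fun J => decide (J.release ≤ t)) := by
    intro S n hn hk h
    obtain ⟨d, rfl⟩ := Nat.exists_eq_add_of_le hk
    simp only [Input.revealed, input, List.range_add, List.map_append, List.filter_append]
    refine (congrArg _ (List.filter_eq_nil_iff.2 fun J hJ => ?_)).trans (List.append_nil _)
    simp only [List.map_map, List.mem_map, List.mem_range] at hJ
    obtain ⟨i, hi, rfl⟩ := hJ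
    rw [Bool.not_eq_true]
    exact decide_eq_false (not_le.2 (h (k + i) (by omega) (by omega)))
  rw [key S n hn hk h, key S' n' hn' hk' h']
  congr 1
  refine List.map_congr_left fun i hi => ?_
  have hi := List.mem_range.1 hi
  simp [job, hr i hi, hp i hi]

/-! ### Service, completion and cost -/

variable {σ : Schedule N}

/-- The amount of service that the `i`-th job of a single-task instance has received up to
time `t`. -/
noncomputable def _root_.MPMS.Schedule.work (σ : Schedule N) (i : ℕ) (t : ℝ) : ℝ :=
  (volume (σ.served (i, 0) ∩ Iic t)).toReal

theorem jobCompletion_input (i : Fin (S.input np n hn).jobs.length) :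
    jobCompletion (S.input np n hn) σ i = σ.completion (i, 0) (S.p i) := by
  obtain ⟨i, hi⟩ := i
  have h : ∀ l : Fin (S.input np n hn).jobs[i].tasks.length,
      σ.completion (i, l) (S.input np n hn).jobs[i].tasks[l].size
        = σ.completion (i, 0) (S.p i) := by
    rintro ⟨l, hl⟩
    have : l = 0 := by simpa [input, job] using hl
    subst this
    simp [input, job]
  unfold jobCompletion
  have : Nonempty (Fin (S.input np n hn).jobs[i].tasks.length) := ⟨⟨0, by simp [input, job]⟩⟩
  exact (iSup_congr h).trans ciSup_const

theorem cost_input : cost (S.input np n hn) σ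
    = ∑ i ∈ Finset.range n, (σ.completion (i, 0) (S.p i) - S.r i) := by
  unfold cost
  rw [Finset.sum_range]
  refine Fintype.sum_equiv (finCongr input_length) _ _ fun i => ?_
  obtain ⟨i, hi⟩ := i
  rw [jobCompletion_input]
  simp only [Fin.getElem_fin, input_getElem, job]
  rfl

theorem service_input (hσ : Feasible (S.input np n hn) σ)
    {i : ℕ} (hi : i < n) :
    volume (σ.served (i, 0)) = ENNReal.ofReal (S.p i) := by
  have := hσ.service ⟨i, by rwa [input_length]⟩ ⟨0, by simp [input, job]⟩
  simpa [input, job] using this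

theorem exists_complete_input (hσ : Feasible (S.input np n hn) σ)
    {i : ℕ} (hi : i < n) :
    ∃ T : ℝ, volume (σ.served (i, 0) ∩ Iic T) = ENNReal.ofReal (S.p i) := by
  have := hσ.complete ⟨i, by rwa [input_length]⟩ ⟨0, by simp [input, job]⟩
  simpa [input, job] using this

theorem release_le_of_served (hσ : Feasible (S.input np n hn) σ)
    {i : ℕ} {t : ℝ} (ht : t ∈ σ.served (i, 0)) : i < n ∧ S.r i ≤ t := by
  obtain ⟨m, hm⟩ := ht
  obtain ⟨h, -, h'⟩ := hσ.valid m t i 0 hm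
  refine ⟨by rwa [input_length] at h, ?_⟩
  simpa [input, job] using h'

theorem measurableSet_served (hσ : Feasible (S.input np n hn) σ)
    (i : ℕ) : MeasurableSet (σ.served (i, 0)) := by
  have : σ.served (i, 0) = ⋃ m, {t | σ m t = some (i, 0)} := by ext; simp [Schedule.served]
  rw [this]
  exact MeasurableSet.iUnion fun m => hσ.measurable m _

theorem served_inter_Iic_subset (hσ : Feasible (S.input np n hn) σ) (i : ℕ) (t : ℝ) :
    σ.served (i, 0) ∩ Iic t ⊆ Icc (S.r i) t :=
  fun _ h => ⟨(release_le_of_served hσ h.1).2, h.2⟩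

theorem volume_served_Iic_ne_top (hσ : Feasible (S.input np n hn) σ) (i : ℕ) (t : ℝ) :
    volume (σ.served (i, 0) ∩ Iic t) ≠ ⊤ :=
  ((measure_mono (served_inter_Iic_subset hσ i t)).trans_lt (by simp)).ne

theorem work_nonneg (i : ℕ) (t : ℝ) : 0 ≤ σ.work i t := ENNReal.toReal_nonneg

theorem work_le (hσ : Feasible (S.input np n hn) σ) {i : ℕ} (hi : i < n) (t : ℝ) :
    σ.work i t ≤ S.p i := by
  refine ENNReal.toReal_le_of_le_ofReal (S.p_pos i).le ?_
  rw [← service_input hσ hi]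
  exact measure_mono inter_subset_left

theorem work_eq_zero (hσ : Feasible (S.input np n hn) σ) {i : ℕ} {t : ℝ} (ht : t ≤ S.r i) :
    σ.work i t = 0 := by
  have : volume (σ.served (i, 0) ∩ Iic t) ≤ 0 :=
    (measure_mono (served_inter_Iic_subset hσ i t)).trans (by simp [ht])
  simp [Schedule.work, nonpos_iff_eq_zero.1 this]

theorem work_sub (hσ : Feasible (S.input np n hn) σ) (i : ℕ) {t t' : ℝ} (h : t ≤ t') :
    σ.work i t' - σ.work i t = (volume (σ.served (i, 0) ∩ Ioc t t')).toReal := by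
  have hU : σ.served (i, 0) ∩ Iic t' = (σ.served (i, 0) ∩ Iic t) ∪ (σ.served (i, 0) ∩ Ioc t t') := by
    rw [← inter_union_distrib_left, Iic_union_Ioc_eq_Iic h]
  have hd : Disjoint (σ.served (i, 0) ∩ Iic t) (σ.served (i, 0) ∩ Ioc t t') :=
    (Iic_disjoint_Ioc le_rfl).mono inter_subset_right inter_subset_right
  have hf : volume (σ.served (i, 0) ∩ Ioc t t') ≠ ⊤ :=
    ((measure_mono inter_subset_right).trans_lt (by simp : volume (Ioc t t') < ⊤)).ne
  unfold Schedule.work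
  rw [hU, measure_union hd ((measurableSet_served hσ i).inter measurableSet_Ioc),
    ENNReal.toReal_add (volume_served_Iic_ne_top hσ i t) hf]
  ring

theorem work_mono (hσ : Feasible (S.input np n hn) σ) (i : ℕ) {t t' : ℝ} (h : t ≤ t') :
    σ.work i t ≤ σ.work i t' := by
  have := work_sub hσ i h
  have : 0 ≤ (volume (σ.served (i, 0) ∩ Ioc t t')).toReal := ENNReal.toReal_nonneg
  linarith

theorem work_sub_le (hσ : Feasible (S.input np n hn) σ) (i : ℕ) {t t' : ℝ} (h : t ≤ t') :
    σ.work i t' - σ.work i t ≤ t' - t := by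
  rw [work_sub hσ i h]
  refine ENNReal.toReal_le_of_le_ofReal (by linarith) ?_
  exact (measure_mono inter_subset_right).trans (by simp)

/-- In a time interval, the machines do not provide more service than their number times its
length. -/
theorem sum_work_sub_le (hσ : Feasible (S.input np n hn) σ) (Q : Finset ℕ) {t t' : ℝ}
    (h : t ≤ t') : ∑ i ∈ Q, (σ.work i t' - σ.work i t) ≤ N * (t' - t) := by
  have hf : ∀ i ∈ Q, volume (σ.served (i, 0) ∩ Ioc t t') ≠ ⊤ := fun i _ =>
    ((measure_mono inter_subset_right).trans_lt (by simp : volume (Ioc t t') < ⊤)).ne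
  rw [Finset.sum_congr rfl fun i _ => work_sub hσ i h, ← ENNReal.toReal_sum hf]
  refine ENNReal.toReal_le_of_le_ofReal (by have := sub_nonneg.2 h; positivity) ?_
  calc ∑ i ∈ Q, volume (σ.served (i, 0) ∩ Ioc t t')
      ≤ ∑ i ∈ Q, ∑ m, volume ({u | σ m u = some (i, 0)} ∩ Ioc t t') := by
        refine Finset.sum_le_sum fun i _ => ?_
        have : σ.served (i, 0) ∩ Ioc t t' ⊆ ⋃ m, ({u | σ m u = some (i, 0)} ∩ Ioc t t') := by
          rintro u ⟨⟨m, hm⟩, hu⟩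
          exact mem_iUnion.2 ⟨m, hm, hu⟩
        refine (measure_mono this).trans ?_
        exact (measure_iUnion_le _).trans (by rw [tsum_fintype])
    _ = ∑ m, ∑ i ∈ Q, volume ({u | σ m u = some (i, 0)} ∩ Ioc t t') := Finset.sum_comm
    _ ≤ ∑ _m : Fin N, volume (Ioc t t') := by
        refine Finset.sum_le_sum fun m _ => ?_
        -- A machine serves one task at a time, so its service sets for different jobs are disjoint.
        rw [← measure_biUnion_finset]
        · exact measure_mono (iUnion₂_subset fun i _ => inter_subset_right)
        · intro i _ j _ hij
          refine Set.disjoint_left.2 fun u hu hu' => hij ?_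
          have := hu.1.symm.trans hu'.1
          simpa using this
        · exact fun i _ => (hσ.measurable m _).inter measurableSet_Ioc
    _ = ENNReal.ofReal (N * (t' - t)) := by
        rw [ENNReal.ofReal_mul (by positivity)]
        simp

/-- The strict inequality makes it unnecessary to know that the infimum defining the completion time
is attained. -/
theorem work_eq_of_completion_lt (hσ : Feasible (S.input np n hn) σ) {i : ℕ} (hi : i < n)
    {t : ℝ} (ht : σ.completion (i, 0) (S.p i) < t) : σ.work i t = S.p i := by
  obtain ⟨T, hT, hTt⟩ := exists_lt_of_csInf_lt (exists_complete_input hσ hi) ht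
  refine le_antisymm (work_le hσ hi t) ?_
  have := work_mono hσ i hTt.le
  rwa [Schedule.work, hT, ENNReal.toReal_ofReal (S.p_pos i).le] at this

/-- Service accrues at rate at most one after the release. This also bounds below the set whose
infimum is the completion time, which `completion_le` needs. -/
theorem release_add_le_of_complete (hσ : Feasible (S.input np n hn) σ) {i : ℕ} {T : ℝ}
    (hT : volume (σ.served (i, 0) ∩ Iic T) = ENNReal.ofReal (S.p i)) : S.r i + S.p i ≤ T := by
  have hw : σ.work i T = S.p i := by
    rw [Schedule.work, hT, ENNReal.toReal_ofReal (S.p_pos i).le]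
  have hp := S.p_pos i
  rcases le_total T (S.r i) with h | h
  · rw [work_eq_zero hσ h] at hw
    linarith
  · have := work_sub_le hσ i h
    rw [work_eq_zero hσ le_rfl] at this
    linarith

theorem release_add_le_completion (hσ : Feasible (S.input np n hn) σ) {i : ℕ} (hi : i < n) :
    S.r i + S.p i ≤ σ.completion (i, 0) (S.p i) :=
  le_csInf (exists_complete_input hσ hi) fun _ hT => release_add_le_of_complete hσ hT

theorem completion_le (hσ : Feasible (S.input np n hn) σ) {i : ℕ} {T : ℝ}
    (hT : volume (σ.served (i, 0) ∩ Iic T) = ENNReal.ofReal (S.p i)) :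
    σ.completion (i, 0) (S.p i) ≤ T :=
  csInf_le ⟨_, fun _ hT => release_add_le_of_complete hσ hT⟩ hT

/-- A positive lower bound valid for all feasible schedules; it makes the infimum in `opt` bounded
below and positive. -/
theorem p_zero_le_cost (hσ : Feasible (S.input np n hn) σ) :
    S.p 0 ≤ cost (S.input np n hn) σ := by
  rw [cost_input]
  calc S.p 0 ≤ σ.completion (0, 0) (S.p 0) - S.r 0 := by
        have := release_add_le_completion hσ hn
        linarith
    _ ≤ _ := Finset.single_le_sum
        (f := fun i => σ.completion (i, 0) (S.p i) - S.r i) (fun i hi => by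
          have := release_add_le_completion hσ (Finset.mem_range.1 hi)
          have := S.p_pos i
          linarith) (Finset.mem_range.2 hn)

/-- If the fractional number of unfinished jobs is at least `Φ` during `[a, b]`, then the total
response time is at least `Φ * (b - a)`. -/
theorem mul_le_cost (hσ : Feasible (S.input np n hn) σ) {a b Φ : ℝ} (hΦ : 0 ≤ Φ)
    (h : ∀ t ∈ Icc a b, Φ ≤ ∑ i ∈ (Finset.range n).filter (fun i => S.r i ≤ t),
      (1 - σ.work i t / S.p i)) :
    Φ * (b - a) ≤ cost (S.input np n hn) σ := by
  have hC : ∀ i ∈ Finset.range n, 0 ≤ σ.completion (i, 0) (S.p i) - S.r i := fun i hi => by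
    have := release_add_le_completion hσ (Finset.mem_range.1 hi)
    have := S.p_pos i
    linarith
  rw [cost_input, ← ENNReal.ofReal_le_ofReal_iff (Finset.sum_nonneg hC),
    ENNReal.ofReal_sum_of_nonneg hC]
  calc ENNReal.ofReal (Φ * (b - a)) = ∫⁻ _t in Icc a b, ENNReal.ofReal Φ := by
        rw [ENNReal.ofReal_mul hΦ]; simp
    -- The unfinished fraction of a job is at most 1 up to its completion and 0 afterwards, so it is
    -- dominated by the indicator of the interval from release to completion.
    _ ≤ ∫⁻ t in Icc a b, ∑ i ∈ Finset.range n,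
          (Icc (S.r i) (σ.completion (i, 0) (S.p i))).indicator (fun _ => (1 : ENNReal)) t := by
        refine setLIntegral_mono' measurableSet_Icc fun t ht => ?_
        refine (ENNReal.ofReal_le_ofReal (h t ht)).trans ?_
        have h0 : ∀ i ∈ (Finset.range n).filter (fun i => S.r i ≤ t),
            0 ≤ 1 - σ.work i t / S.p i := fun i hi => by
          have := work_le hσ (Finset.mem_range.1 (Finset.mem_filter.1 hi).1) t
          rw [sub_nonneg, div_le_one (S.p_pos i)]
          exact this
        rw [ENNReal.ofReal_sum_of_nonneg h0]
        refine le_trans (Finset.sum_le_sum fun i hi => ?_)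
          (Finset.sum_le_sum_of_subset (Finset.filter_subset _ _))
        obtain ⟨hi, hr⟩ := Finset.mem_filter.1 hi
        rcases le_or_gt t (σ.completion (i, 0) (S.p i)) with hc | hc
        · rw [indicator_of_mem (show t ∈ Icc _ _ from ⟨hr, hc⟩)]
          refine ENNReal.ofReal_le_one.2 ?_
          have : 0 ≤ σ.work i t / S.p i := div_nonneg (work_nonneg i t) (S.p_pos i).le
          linarith
        · rw [work_eq_of_completion_lt hσ (Finset.mem_range.1 hi) hc, div_self (S.p_pos i).ne']
          simp
    _ ≤ ∫⁻ t, ∑ i ∈ Finset.range n,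
          (Icc (S.r i) (σ.completion (i, 0) (S.p i))).indicator (fun _ => (1 : ENNReal)) t :=
        setLIntegral_le_lintegral _ _
    _ = ∑ i ∈ Finset.range n, ENNReal.ofReal (σ.completion (i, 0) (S.p i) - S.r i) := by
        rw [lintegral_finsetSum _ fun i _ => measurable_const.indicator measurableSet_Icc]
        simp [lintegral_indicator measurableSet_Icc]

/-! ### Offline plans without interruptions -/

/-- The schedule that runs the `i`-th job without interruption on the machine `mach i` from time
`st i` on. -/
noncomputable def planSchedule (S : JobStream) (n : ℕ) (mach : ℕ → Fin N) (st : ℕ → ℝ) :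
    Schedule N := by
  classical
  exact fun m t => if h : ∃ i < n, mach i = m ∧ st i ≤ t ∧ t < st i + S.p i
    then some (h.choose, 0) else none

section Plan

variable {mach : ℕ → Fin N} {st : ℕ → ℝ}

/-- Non-overlap leaves at most one candidate job per machine and time, so the choice in
`planSchedule` is forced. -/
theorem planSchedule_eq_some
    (hd : ∀ i j, i < j → j < n → mach i = mach j → st i + S.p i ≤ st j ∨ st j + S.p j ≤ st i)
    {m : Fin N} {t : ℝ} {i l : ℕ} :
    S.planSchedule n mach st m t = some (i, l) ↔
      l = 0 ∧ i < n ∧ mach i = m ∧ st i ≤ t ∧ t < st i + S.p i := by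
  have huniq : ∀ i j, i < n → j < n → mach i = mach j → st i ≤ t → t < st i + S.p i →
      st j ≤ t → t < st j + S.p j → i = j := by
    intro i j hi hj hm h1 h2 h3 h4
    rcases lt_trichotomy i j with h | h | h
    · rcases hd i j h hj hm with h' | h' <;> linarith
    · exact h
    · rcases hd j i h hi hm.symm with h' | h' <;> linarith
  unfold planSchedule
  split_ifs with h
  · obtain ⟨h1, h2, h3, h4⟩ := h.choose_spec
    rw [Option.some.injEq, Prod.mk.injEq]
    constructor
    · rintro ⟨hi, rfl⟩
      rw [← hi]
      exact ⟨rfl, h1, h2, h3, h4⟩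
    · rintro ⟨rfl, g1, g2, g3, g4⟩
      exact ⟨huniq _ _ h1 g1 (h2.trans g2.symm) h3 h4 g3 g4, rfl⟩
  · simp only [false_iff]
    rintro ⟨-, h'⟩
    exact h ⟨i, h'⟩

theorem served_planSchedule
    (hd : ∀ i j, i < j → j < n → mach i = mach j → st i + S.p i ≤ st j ∨ st j + S.p j ≤ st i)
    {i : ℕ} (hi : i < n) :
    (S.planSchedule n mach st).served (i, 0) = Ico (st i) (st i + S.p i) := by
  ext t
  simp [Schedule.served, planSchedule_eq_some hd, hi]

theorem feasible_planSchedule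
    (hr : ∀ i < n, S.r i ≤ st i)
    (hd : ∀ i j, i < j → j < n → mach i = mach j → st i + S.p i ≤ st j ∨ st j + S.p j ≤ st i) :
    Feasible (S.input np n hn) (S.planSchedule n mach st) where
  valid m t i l h := by
    obtain ⟨rfl, hi, -, h, -⟩ := (planSchedule_eq_some hd).1 h
    refine ⟨by rwa [input_length], ?_⟩
    simpa [input, job] using (hr i hi).trans h
  measurable m τ := by
    obtain ⟨i, l⟩ := τ
    simp only [planSchedule_eq_some hd]
    by_cases h : l = 0 ∧ i < n ∧ mach i = m
    · have : {t | l = 0 ∧ i < n ∧ mach i = m ∧ st i ≤ t ∧ t < st i + S.p i}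
          = Ico (st i) (st i + S.p i) := by
        ext t; simp [h]
      rw [this]
      exact measurableSet_Ico
    · have : {t | l = 0 ∧ i < n ∧ mach i = m ∧ st i ≤ t ∧ t < st i + S.p i} = ∅ := by
        ext t
        simp only [mem_ofPred_eq, mem_empty_iff_false, iff_false]
        tauto
      rw [this]
      exact MeasurableSet.empty
  single m m' t τ h h' := by
    obtain ⟨i, l⟩ := τ
    rw [planSchedule_eq_some hd] at h h'
    exact h.2.2.1.symm.trans h'.2.2.1
  service := by
    rintro ⟨i, hi⟩ ⟨l, hl⟩
    have hl0 : l = 0 := by simpa [input, job] using hl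
    subst hl0
    rw [input_length] at hi
    simp [input, job, served_planSchedule hd hi]
  complete := by
    rintro ⟨i, hi⟩ ⟨l, hl⟩
    have hl0 : l = 0 := by simpa [input, job] using hl
    subst hl0
    rw [input_length] at hi
    refine ⟨st i + S.p i, ?_⟩
    have : Ico (st i) (st i + S.p i) ∩ Iic (st i + S.p i) = Ico (st i) (st i + S.p i) :=
      inter_eq_left.2 fun x hx => hx.2.le
    simp [input, job, served_planSchedule hd hi, this]
  nonpreempt := by
    rintro ⟨i, hi⟩ ⟨l, hl⟩ -
    have hl0 : l = 0 := by simpa [input, job] using hl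
    subst hl0
    rw [input_length] at hi
    refine ⟨mach i, st i, fun m' t => ?_⟩
    simp [input, job, planSchedule_eq_some hd, hi, eq_comm]

/-- The optimal cost is at most the cost of any plan that runs every job without interruption. -/
theorem opt_le_of_plan (mach : ℕ → Fin N) (st : ℕ → ℝ) (hr : ∀ i < n, S.r i ≤ st i)
    (hd : ∀ i j, i < j → j < n → mach i = mach j → st i + S.p i ≤ st j ∨ st j + S.p j ≤ st i) :
    opt N (S.input np n hn) ≤ ∑ i ∈ Finset.range n, (st i + S.p i - S.r i) := by
  have hF : Feasible (S.input np n hn) (S.planSchedule n mach st) := feasible_planSchedule hr hd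
  have hB : BddBelow {c | ∃ σ : Schedule N, Feasible (S.input np n hn) σ ∧
      c = cost (S.input np n hn) σ} := by
    refine ⟨S.p 0, ?_⟩
    rintro c ⟨σ, hσ, rfl⟩
    exact p_zero_le_cost hσ
  refine (csInf_le hB ⟨_, hF, rfl⟩).trans ?_
  rw [cost_input]
  refine Finset.sum_le_sum fun i hi => ?_
  have hi := Finset.mem_range.1 hi
  have hI : Ico (st i) (st i + S.p i) ∩ Iic (st i + S.p i) = Ico (st i) (st i + S.p i) :=
    inter_eq_left.2 fun x hx => hx.2.le
  have := completion_le hF (i := i) (T := st i + S.p i) (by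
    rw [served_planSchedule hd hi, hI]; simp)
  linarith

end Plan

/-- A feasible schedule has to be supplied, since the infimum of the empty set would be 0. -/
theorem opt_pos (hσ : Feasible (S.input np n hn) σ) : 0 < opt N (S.input np n hn) := by
  refine (S.p_pos 0).trans_le (le_csInf ⟨_, σ, hσ, rfl⟩ ?_)
  rintro c ⟨σ, hσ, rfl⟩
  exact p_zero_le_cost hσ

/-- The instant `T` is a null set. This matters because a burst released at `T` is already visible
at `T`, so causality gives agreement only before it. -/
theorem work_eq_of_agree {σ' : Schedule N} {T t : ℝ} (h : ∀ t < T, ∀ m, σ m t = σ' m t) (i : ℕ)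
    (ht : t ≤ T) : σ.work i t = σ'.work i t := by
  unfold Schedule.work
  congr 1
  refine measure_congr ?_
  have : ∀ᵐ u : ℝ, u ≠ T := by simp [ae_iff]
  filter_upwards [this] with u hu
  refine propext (and_congr_left fun hut => ?_)
  have : u < T := lt_of_le_of_ne (le_trans hut ht) hu
  exact exists_congr fun m => by rw [h u this m]

end JobStream

/-- An upper bound on the competitive ratio of a class bounds the cost on each of its
instances. -/
theorem cost_le_of_ratio {N : ℕ} {A : OnlineAlgorithm N} {S : Set Input} {c : ℝ} {ω : Input}
    (h : competitiveRatio A S ≤ ENNReal.ofReal c) (hω : ω ∈ S) (hc : 0 ≤ c)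
    (ho : 0 < opt N ω) : cost ω (A.run ω) ≤ c * opt N ω := by
  have h1 : ENNReal.ofReal (cost ω (A.run ω) / opt N ω) ≤ competitiveRatio A S :=
    le_iSup₂ (f := fun ω (_ : ω ∈ S) => ENNReal.ofReal (cost ω (A.run ω) / opt N ω)) ω hω
  have h2 := (ENNReal.ofReal_le_ofReal_iff hc).1 (h1.trans h)
  rwa [div_le_iff₀ ho] at h2

/-! ### Bursts of unit jobs -/

namespace JobStream

variable {S : JobStream} {np : Bool} {N : ℕ} {σ : Schedule N}

/-- In a burst of `N` jobs per unit of time, at least `N * t` jobs arrive within time `t`. -/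
theorem mul_le_card_burst (hN : 1 ≤ N) (D : ℕ) {T t : ℝ} (ht : t ∈ Icc T (T + D)) :
    N * (t - T) ≤
      (((Finset.range (N * D)).filter (fun j => T + ((j / N : ℕ) : ℝ) ≤ t)).card : ℝ) := by
  have hN0 : (0 : ℝ) ≤ N := by positivity
  -- By time `t` the batches number `⌊t - T⌋ + 1`, except at the right end point, where there are
  -- only `D` of them.
  rcases ht.2.eq_or_lt with h | h
  · rw [Finset.filter_true_of_mem]
    · simp [h]
    · intro j hj
      have : j / N < D := Nat.div_lt_of_lt_mul (Finset.mem_range.1 hj)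
      have : ((j / N : ℕ) : ℝ) < D := by exact_mod_cast this
      linarith
  · have h0 : 0 ≤ t - T := sub_nonneg.2 ht.1
    have hf : ⌊t - T⌋₊ < D := (Nat.floor_lt h0).2 (by linarith)
    have hsub : Finset.range (N * (⌊t - T⌋₊ + 1)) ⊆
        (Finset.range (N * D)).filter (fun j => T + ((j / N : ℕ) : ℝ) ≤ t) := by
      intro j hj
      have hj := Finset.mem_range.1 hj
      have h1 : j / N ≤ ⌊t - T⌋₊ := Nat.le_of_lt_succ (Nat.div_lt_of_lt_mul hj)
      have h2 : ((j / N : ℕ) : ℝ) ≤ t - T := (Nat.le_floor_iff h0).1 h1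
      refine Finset.mem_filter.2 ⟨Finset.mem_range.2 (hj.trans_le ?_), by linarith⟩
      exact Nat.mul_le_mul_left _ hf
    have hc := Finset.card_le_card hsub
    rw [Finset.card_range] at hc
    calc (N : ℝ) * (t - T) ≤ N * (⌊t - T⌋₊ + 1) :=
          mul_le_mul_of_nonneg_left (Nat.lt_floor_add_one _).le hN0
      _ ≤ _ := by exact_mod_cast hc

/-- A lower bound on the fractional number of unfinished jobs during a burst of `N` unit jobs per
unit of time that starts at time `T`, after `k` other jobs. -/
theorem le_pending_of_burst {k D : ℕ} {T : ℝ} (hN : 1 ≤ N)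
    (hr : ∀ i < k, S.r i ≤ T)
    (hbr : ∀ j, S.r (k + j) = T + ((j / N : ℕ) : ℝ)) (hbp : ∀ j, S.p (k + j) = 1)
    {t : ℝ} (ht : t ∈ Icc T (T + D)) :
    ∑ i ∈ Finset.range k, (1 - σ.work i t / S.p i) + N * (t - T)
        - ∑ j ∈ Finset.range (N * D), σ.work (k + j) t
      ≤ ∑ i ∈ (Finset.range (k + N * D)).filter (fun i => S.r i ≤ t),
        (1 - σ.work i t / S.p i) := by
  rw [Finset.sum_filter, Finset.sum_range_add, add_sub_assoc]
  refine add_le_add (Finset.sum_le_sum fun i hi => ?_) ?_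
  · rw [if_pos ((hr i (Finset.mem_range.1 hi)).trans ht.1)]
  · refine (sub_le_sub_right (mul_le_card_burst hN D ht) _).trans ?_
    rw [Finset.card_filter, Nat.cast_sum, ← Finset.sum_sub_distrib]
    refine Finset.sum_le_sum fun j _ => ?_
    rw [hbr, hbp]
    split_ifs with h
    · simp
    · have := work_nonneg (σ := σ) (k + j) t
      simp only [Nat.cast_zero]
      linarith

/-- A single long job, followed from time `s + 1` on by a burst of unit jobs. -/
def longThenBurst (N : ℕ) (b s : ℝ) (hb : 0 < b) (hs : 0 ≤ s) : JobStream where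
  r i := if i = 0 then 0 else s + 1 + (((i - 1) / N : ℕ) : ℝ)
  p i := if i = 0 then b else 1
  r_nonneg i := by split_ifs <;> positivity
  p_pos i := by split_ifs <;> positivity
  mono i j h := by
    dsimp only
    split_ifs with hi hj hj
    · exact le_rfl
    · positivity
    · omega
    · have : (i - 1) / N ≤ (j - 1) / N := Nat.div_le_div_right (by omega)
      have : (((i - 1) / N : ℕ) : ℝ) ≤ (((j - 1) / N : ℕ) : ℝ) := by exact_mod_cast this
      linarith

theorem longThenBurst_p_le {b s : ℝ} {hb : 0 < b} {hs : 0 ≤ s} (h1 : 1 ≤ b) (i : ℕ) :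
    1 ≤ (longThenBurst N b s hb hs).p i ∧ (longThenBurst N b s hb hs).p i ≤ b := by
  simp only [longThenBurst]
  split_ifs <;> simp [h1]

/-- The long job may be run at any time that does not interfere with the burst. -/
theorem opt_longThenBurst_le {b s : ℝ} {hb : 0 < b} {hs : 0 ≤ s} {k : ℕ} (hN : 1 ≤ N)
    {hn : 0 < 1 + N * k} (X : ℝ) (hX : 0 ≤ X) (hX' : X + b ≤ s + 1 ∨ s + 1 + k ≤ X) :
    opt N ((longThenBurst N b s hb hs).input np (1 + N * k) hn) ≤ X + b + N * k := by
  set S := longThenBurst N b s hb hs with hS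
  have hN0 : 0 < N := hN
  have hr0 : S.r 0 = 0 := by simp [hS, longThenBurst]
  have hp0 : S.p 0 = b := by simp [hS, longThenBurst]
  have hr1 : ∀ i, S.r (i + 1) = s + 1 + ((i / N : ℕ) : ℝ) := by simp [hS, longThenBurst]
  have hp1 : ∀ i, S.p (i + 1) = 1 := by simp [hS, longThenBurst]
  have hmain := opt_le_of_plan (S := S) (np := np) (n := 1 + N * k) (hn := hn)
    -- Truncated subtraction puts the long job on machine 0. Unit jobs sharing a machine belong to
    -- different batches, hence start at least one unit apart.
    (fun i => ⟨(i - 1) % N, Nat.mod_lt _ hN0⟩) (fun i => if i = 0 then X else S.r i)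
    (by
      intro i _
      split_ifs with h
      · rw [h, hr0]; exact hX
      · exact le_rfl)
    (by
      intro i j hij hj hm
      obtain ⟨j, rfl⟩ : ∃ j', j = j' + 1 := ⟨j - 1, by omega⟩
      have hj' : j / N + 1 ≤ k := Nat.div_lt_of_lt_mul (by omega)
      have hj'' : ((j / N : ℕ) : ℝ) + 1 ≤ k := by exact_mod_cast hj'
      have hj0 : (0 : ℝ) ≤ ((j / N : ℕ) : ℝ) := by positivity
      rcases Nat.eq_zero_or_pos i with rfl | hi
      · simp only [if_true, Nat.add_eq_zero_iff, one_ne_zero, and_false, if_false, hr1, hp0, hp1]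
        rcases hX' with h | h
        · left; linarith
        · right; linarith
      · obtain ⟨i, rfl⟩ : ∃ i', i = i' + 1 := ⟨i - 1, by omega⟩
        simp only [Nat.add_eq_zero_iff, one_ne_zero, and_false, if_false, hr1, hp1,
          Fin.mk.injEq, Nat.add_sub_cancel] at hm ⊢
        left
        have h1 : i / N ≤ j / N := Nat.div_le_div_right (by omega)
        have h2 : i / N ≠ j / N := by
          intro h
          have := Nat.div_add_mod i N
          have := Nat.div_add_mod j N
          rw [h, hm] at *
          omega
        have h3 : i / N + 1 ≤ j / N := by omega
        have h4 : ((i / N : ℕ) : ℝ) + 1 ≤ ((j / N : ℕ) : ℝ) := by exact_mod_cast h3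
        linarith)
  refine hmain.trans (le_of_eq ?_)
  rw [Finset.sum_range_add]
  simp [add_comm 1, hr0, hp0, hp1]

end JobStream

/-! ### The lower bound for non-preemptive tasks -/

open JobStream

/-- For non-preemptive jobs, every online algorithm is beaten by a factor of order `β`. -/
theorem exists_nonpreemptive_hard {N : ℕ} (hN : 1 ≤ N) (A : OnlineAlgorithm N) (k : ℕ)
    (hk : 1 ≤ k) :
    ∃ ω ∈ singleTask true, ω.alpha = 2 * k + 2 ∧ ω.beta = 2 * k + 2 ∧ 0 < opt N ω ∧
      opt N ω ≤ (N + 10) * k ∧ (k : ℝ) ^ 2 / 4 ≤ cost ω (A.run ω) := by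
  have hk1 : (1 : ℝ) ≤ k := by exact_mod_cast hk
  have hNk : 1 ≤ N * k := Nat.mul_pos hN hk
  set b : ℝ := 2 * k + 2 with hbdef
  have hb : 0 < b := by positivity
  set S₀ : JobStream := ⟨fun _ => 0, fun _ => b, fun _ => le_rfl, fun _ => hb, fun _ _ _ => le_rfl⟩
    with hS₀
  have hF₀ := A.feasible (S₀.input true 1 one_pos)
  obtain ⟨m, s, hms⟩ := hF₀.nonpreempt ⟨0, by simp [input_length]⟩ ⟨0, by simp [input, job]⟩
    (by simp [input, job])
  replace hms : ∀ m' t, A.run (S₀.input true 1 one_pos) m' t = some (0, 0) ↔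
      m' = m ∧ s ≤ t ∧ t < s + b := by simpa [input, job, hS₀] using hms
  have hs : 0 ≤ s :=
    (release_le_of_served hF₀ ⟨m, (hms m s).2 ⟨rfl, le_rfl, by linarith⟩⟩).2
  set S := longThenBurst N b s hb hs with hS
  have hn : 0 < 1 + N * k := by omega
  set ω := S.input true (1 + N * k) hn with hω
  have hr0 : S.r 0 = 0 := by simp [hS, longThenBurst]
  have hp0 : S.p 0 = b := by simp [hS, longThenBurst]
  have hr1 : ∀ j, S.r (1 + j) = s + 1 + ((j / N : ℕ) : ℝ) := by simp [hS, longThenBurst]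
  have hp1 : ∀ j, S.p (1 + j) = 1 := by simp [hS, longThenBurst]
  have hple : ∀ i, 1 ≤ S.p i ∧ S.p i ≤ b := longThenBurst_p_le (by linarith)
  have hpmax : ω.pmax = b := by
    rw [hω, pmax_input 0 hn (fun i _ => by rw [hp0]; exact (hple i).2), hp0]
  have heta : ω.eta = b := by
    rw [hω, eta_input 0 hn (fun i _ => by rw [hp0]; exact (hple i).2), hp0]
  have hpmin : ω.pmin = 1 := by
    rw [hω, pmin_input (1 + 0) (by omega) (fun i _ => by rw [hp1]; exact (hple i).1), hp1]
  have hF := A.feasible ω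
  refine ⟨ω, input_mem_singleTask, by rw [Input.alpha, hpmax, hpmin, div_one],
    by rw [Input.beta, heta, hpmin, div_one], opt_pos hF, ?_, ?_⟩
  -- A late start leaves room for the long job before the burst. Otherwise `s < b`, and waiting
  -- until after the burst still costs only a multiple of `k`.
  · rcases le_or_gt b s with h | h
    · refine (opt_longThenBurst_le hN 0 le_rfl (Or.inl (by linarith))).trans ?_
      nlinarith
    · refine (opt_longThenBurst_le hN (s + 1 + k) (by positivity) (Or.inr le_rfl)).trans ?_
      nlinarith
  -- The burst begins at `s + 1` rather than `s` so that the two runs agree at the starting time `s`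
  -- itself.
  · have hagree : ∀ t < s + 1, ∀ m', A.run ω m' t = A.run (S₀.input true 1 one_pos) m' t := by
      intro t ht
      refine A.causal _ _ t (revealed_input_eq 1 t (by omega) le_rfl ?_ ?_ ?_ ?_)
      · intro i hi
        obtain rfl : i = 0 := by omega
        exact hr0
      · intro i hi
        obtain rfl : i = 0 := by omega
        exact hp0
      · intro i hi _
        obtain ⟨j, rfl⟩ := Nat.exists_eq_add_of_le hi
        rw [hr1]
        have : (0 : ℝ) ≤ ((j / N : ℕ) : ℝ) := by positivity
        linarith
      · intro i h h'
        omega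
    obtain ⟨m₁, s₁, hms₁⟩ := hF.nonpreempt ⟨0, by rw [hω, input_length]; exact hn⟩
      ⟨0, by simp [hω, input, job]⟩ (by simp [hω, input, job])
    replace hms₁ : ∀ m' t, A.run ω m' t = some (0, 0) ↔ m' = m₁ ∧ s₁ ≤ t ∧ t < s₁ + b := by
      simpa [hω, input, job, hp0] using hms₁
    have h1 : s₁ ≤ s := by
      have : A.run ω m s = some (0, 0) := by
        rw [hagree s (by linarith), hms]
        exact ⟨rfl, le_rfl, by linarith⟩
      exact ((hms₁ _ _).1 this).2.1
    have h2 : s ≤ s₁ := by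
      have : A.run ω m₁ s₁ = some (0, 0) := (hms₁ _ _).2 ⟨rfl, le_rfl, by linarith⟩
      rw [hagree s₁ (by linarith), hms] at this
      exact this.2.1
    obtain rfl : s₁ = s := le_antisymm h1 h2
    -- Since `b > k + 1`, the long job occupies its machine until the end of the burst.
    have hbig : ∀ t ∈ Icc (s₁ + 1) (s₁ + 1 + k),
        (A.run ω).work 0 t - (A.run ω).work 0 (s₁ + 1) = t - (s₁ + 1) := by
      intro t ht
      have hsub : Ioc (s₁ + 1) t ⊆ (A.run ω).served (0, 0) := fun u hu =>
        ⟨m₁, (hms₁ _ _).2 ⟨rfl, by linarith [hu.1], by linarith [hu.2, ht.2]⟩⟩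
      rw [work_sub hF 0 ht.1, inter_eq_right.2 hsub, Real.volume_Ioc,
        ENNReal.toReal_ofReal (sub_nonneg.2 ht.1)]
    -- With one machine blocked, the backlog at `t` is at least `t - (s₁ + 1)`, hence at least `k /
    -- 2` in the second half of the burst.
    have hcost := mul_le_cost hF (a := s₁ + 1 + k / 2) (b := s₁ + 1 + k) (Φ := k / 2)
      (by positivity) (by
        intro t ht
        have ht' : t ∈ Icc (s₁ + 1) (s₁ + 1 + k) := ⟨by linarith [ht.1], ht.2⟩
        refine le_trans ?_ (le_pending_of_burst hN ?_ hr1 hp1 ht')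
        · have hcap := sum_work_sub_le hF (Finset.range (1 + N * k)) ht'.1
          rw [Finset.sum_range_add, Finset.sum_range_one, hbig t ht'] at hcap
          have hz : ∀ j ∈ Finset.range (N * k),
              (A.run ω).work (1 + j) t - (A.run ω).work (1 + j) (s₁ + 1)
                = (A.run ω).work (1 + j) t := fun j _ => by
            rw [work_eq_zero hF (t := s₁ + 1), sub_zero]
            rw [hr1]
            have : (0 : ℝ) ≤ ((j / N : ℕ) : ℝ) := by positivity
            linarith
          rw [Finset.sum_congr rfl hz] at hcap
          have h0 : (A.run ω).work 0 t / S.p 0 ≤ 1 :=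
            (div_le_one (S.p_pos 0)).2 (work_le hF hn t)
          rw [Finset.sum_range_one]
          linarith [ht.1]
        · intro i hi
          obtain rfl : i = 0 := by omega
          rw [hr0]
          linarith)
    calc (k : ℝ) ^ 2 / 4 = k / 2 * (s₁ + 1 + k - (s₁ + 1 + k / 2)) := by ring
      _ ≤ _ := hcost

/-- No online algorithm has competitive ratio `o(β)` on single non-preemptive tasks. -/
theorem not_ratioLittleO_beta {N : ℕ} (hN : 1 ≤ N) (A : OnlineAlgorithm N) :
    ¬ RatioLittleO A (singleTask true) (fun _ b => b) := by
  intro h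
  have hc : (0 : ℝ) < N + 10 := by positivity
  -- This constant turns the assumed bound into `(2k + 2) k / 32 ≤ k ^ 2 / 8`, below the actual `k ^
  -- 2 / 4`.
  obtain ⟨M, hM⟩ := h (1 / (32 * (N + 10))) (by positivity)
  obtain ⟨k, hk⟩ := exists_nat_ge (max M 1)
  have hk1 : (1 : ℝ) ≤ k := (le_max_right _ _).trans hk
  obtain ⟨ω, hω, ha, hb, ho, hopt, hcost⟩ :=
    exists_nonpreemptive_hard hN A k (by exact_mod_cast hk1)
  have h1 := cost_le_of_ratio
    (hM (2 * k + 2) (2 * k + 2) (by have := (le_max_left M 1).trans hk; linarith))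
    ⟨hω, ha, hb⟩ (by positivity) ho
  have h2 : 1 / (32 * (N + 10)) * (2 * k + 2) * opt N ω
      ≤ 1 / (32 * (N + 10)) * (2 * k + 2) * ((N + 10) * (k : ℝ)) :=
    mul_le_mul_of_nonneg_left hopt (by positivity)
  have h3 : 1 / (32 * (N + 10)) * (2 * k + 2) * ((N + 10) * (k : ℝ))
      = (2 * k + 2) * k / 32 := by
    field_simp
  nlinarith

/-- No online algorithm has competitive ratio `o(ln α + β)` on all instances. -/
theorem not_ratioLittleO_log_add_beta {N : ℕ} (hN : 1 ≤ N) (A : OnlineAlgorithm N) :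
    ¬ RatioLittleO A Set.univ (fun a b => Real.log a + b) := by
  intro h
  have hc : (0 : ℝ) < N + 10 := by positivity
  -- The extra factor 2 pays for the logarithm, which is at most `2k + 2`.
  obtain ⟨M, hM⟩ := h (1 / (64 * (N + 10))) (by positivity)
  obtain ⟨k, hk⟩ := exists_nat_ge (max M 1)
  have hk1 : (1 : ℝ) ≤ k := (le_max_right _ _).trans hk
  obtain ⟨ω, hω, ha, hb, ho, hopt, hcost⟩ :=
    exists_nonpreemptive_hard hN A k (by exact_mod_cast hk1)
  have hl0 : 0 ≤ Real.log (2 * k + 2) := Real.log_nonneg (by linarith)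
  have hl1 : Real.log (2 * k + 2) ≤ 2 * k + 2 := Real.log_le_self (by positivity)
  have h1 := cost_le_of_ratio
    (hM (2 * k + 2) (2 * k + 2) (by have := (le_max_left M 1).trans hk; linarith))
    ⟨mem_univ ω, ha, hb⟩ (by positivity) ho
  have h2 : 1 / (64 * (N + 10)) * (Real.log (2 * k + 2) + (2 * k + 2)) * opt N ω
      ≤ 1 / (64 * (N + 10)) * (2 * (2 * k + 2)) * ((N + 10) * (k : ℝ)) := by
    gcongr
    linarith
  have h3 : 1 / (64 * (N + 10)) * (2 * (2 * k + 2)) * ((N + 10) * (k : ℝ))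
      = (2 * k + 2) * k / 32 := by
    field_simp
    ring
  nlinarith

/-! ### Geometry of the phases -/

/-- Length of the short jobs of the `i`-th phase. -/
noncomputable def shortLen (n i : ℕ) : ℝ := 9 ^ n / 9 ^ i

/-- Length of the `i`-th phase, and of its long job. -/
noncomputable def phaseLen (n i : ℕ) : ℝ := 2 * n * shortLen n i

/-- Start of the `i`-th phase, the sum of the lengths of the earlier phases. -/
noncomputable def phaseStart (n i : ℕ) : ℝ := 9 / 8 * (phaseLen n 0 - phaseLen n i)

theorem shortLen_pos (n i : ℕ) : 0 < shortLen n i := by unfold shortLen; positivity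

theorem one_le_shortLen {n i : ℕ} (h : i ≤ n) : 1 ≤ shortLen n i := by
  unfold shortLen
  rw [one_le_div (by positivity)]
  exact pow_le_pow_right₀ (by norm_num) h

theorem phaseLen_nonneg (n i : ℕ) : 0 ≤ phaseLen n i :=
  mul_nonneg (by positivity) (shortLen_pos n i).le

theorem phaseLen_pos {n : ℕ} (hn : 1 ≤ n) (i : ℕ) : 0 < phaseLen n i :=
  mul_pos (by positivity) (shortLen_pos n i)

theorem phaseLen_succ (n i : ℕ) : phaseLen n (i + 1) = phaseLen n i / 9 := by
  unfold phaseLen shortLen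
  rw [pow_succ]
  field_simp

theorem phaseLen_zero (n : ℕ) : phaseLen n 0 = ((2 * n * 9 ^ n : ℕ) : ℝ) := by
  simp [phaseLen, shortLen]

theorem phaseLen_antitone (n : ℕ) : Antitone (phaseLen n) :=
  antitone_nat_of_succ_le fun i => by
    rw [phaseLen_succ]
    linarith [phaseLen_nonneg n i]

theorem shortLen_le_phaseLen {n : ℕ} (hn : 1 ≤ n) (i : ℕ) : shortLen n i ≤ phaseLen n i := by
  have h1 : (1 : ℝ) ≤ n := by exact_mod_cast hn
  unfold phaseLen
  nlinarith [shortLen_pos n i]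

theorem phaseStart_succ (n i : ℕ) : phaseStart n (i + 1) = phaseStart n i + phaseLen n i := by
  unfold phaseStart
  rw [phaseLen_succ]
  ring

theorem phaseStart_mono (n : ℕ) : Monotone (phaseStart n) :=
  monotone_nat_of_le_succ fun i => by
    rw [phaseStart_succ]
    linarith [phaseLen_nonneg n i]

theorem phaseStart_nonneg (n i : ℕ) : 0 ≤ phaseStart n i := by
  have := phaseStart_mono n (Nat.zero_le i)
  simpa [phaseStart] using this

/-- A geometric series of ratio `1 / 9`: the later phases together are too short for an old long job
to catch up. -/
theorem phaseStart_sub_le (n i : ℕ) :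
    phaseStart n n - phaseStart n (i + 1) ≤ phaseLen n i / 8 := by
  unfold phaseStart
  rw [phaseLen_succ]
  linarith [phaseLen_nonneg n n]

/-- Intervals in different slots of equal length do not overlap. -/
theorem slots_disjoint {a b : ℕ} (h : a ≠ b) (t : ℝ) {s : ℝ} (hs : 0 ≤ s) :
    t + a * s + s ≤ t + b * s ∨ t + b * s + s ≤ t + a * s := by
  rcases lt_or_gt_of_ne h with h | h
  · left
    have : (a : ℝ) + 1 ≤ b := by exact_mod_cast h
    nlinarith
  · right
    have : (b : ℝ) + 1 ≤ a := by exact_mod_cast h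
    nlinarith

/-- Serves to bound the backlog below by selected jobs only: the short jobs of one phase, or all the
long jobs. -/
theorem sum_range_comp_le {a k : ℕ} {f : ℕ → ℝ} {g : ℕ → ℕ} (hf : ∀ q < k, 0 ≤ f q)
    (hg : Function.Injective g) (hgk : ∀ j < a, g j < k) :
    ∑ j ∈ Finset.range a, f (g j) ≤ ∑ q ∈ Finset.range k, f q := by
  rw [← Finset.sum_image (f := f) (g := g) (s := Finset.range a) (fun _ _ _ _ h => hg h)]
  refine Finset.sum_le_sum_of_subset_of_nonneg ?_ fun q hq _ => hf q (Finset.mem_range.1 hq)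
  intro q hq
  obtain ⟨j, hj, rfl⟩ := Finset.mem_image.1 hq
  exact Finset.mem_range.2 (hgk j (Finset.mem_range.1 hj))

/-! ### Phases followed by a burst -/

namespace JobStream

variable {S : JobStream} {np : Bool} {N : ℕ} {σ : Schedule N}

/-- The fractional number of unfinished jobs does not decrease during a burst of jobs that are
not longer than the other ones. -/
theorem mul_le_cost_of_burst {k D : ℕ} {T Φ : ℝ} {hn : 0 < k + N * D} (hN : 1 ≤ N)
    (hσ : Feasible (S.input np (k + N * D) hn) σ) (hr : ∀ i < k, S.r i ≤ T)
    (hp : ∀ i < k, 1 ≤ S.p i)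
    (hbr : ∀ j, S.r (k + j) = T + ((j / N : ℕ) : ℝ)) (hbp : ∀ j, S.p (k + j) = 1) (hΦ0 : 0 ≤ Φ)
    (hΦ : Φ ≤ ∑ i ∈ Finset.range k, (1 - σ.work i T / S.p i)) :
    Φ * D ≤ cost (S.input np (k + N * D) hn) σ := by
  have := mul_le_cost hσ (a := T) (b := T + D) hΦ0 (by
    intro t ht
    refine le_trans ?_ (le_pending_of_burst hN hr hbr hbp ht)
    have hcap := sum_work_sub_le hσ (Finset.range (k + N * D)) ht.1
    rw [Finset.sum_range_add] at hcap
    have hz : ∀ j ∈ Finset.range (N * D),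
        σ.work (k + j) t - σ.work (k + j) T = σ.work (k + j) t := fun j _ => by
      rw [work_eq_zero hσ (t := T), sub_zero]
      rw [hbr]
      have : (0 : ℝ) ≤ ((j / N : ℕ) : ℝ) := by positivity
      linarith
    rw [Finset.sum_congr rfl hz] at hcap
    -- As the old jobs have length at least 1, a unit of service removes at most one unit of
    -- backlog, whichever job receives it; arrivals make up for the total capacity `N * (t - T)`.
    have hdec : ∑ i ∈ Finset.range k, (1 - σ.work i T / S.p i)
        - ∑ i ∈ Finset.range k, (σ.work i t - σ.work i T)
        ≤ ∑ i ∈ Finset.range k, (1 - σ.work i t / S.p i) := by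
      rw [← Finset.sum_sub_distrib]
      refine Finset.sum_le_sum fun i hi => ?_
      have h1 : (σ.work i t - σ.work i T) / S.p i ≤ σ.work i t - σ.work i T :=
        div_le_self (sub_nonneg.2 (work_mono hσ i ht.1)) (hp i (Finset.mem_range.1 hi))
      rw [sub_div] at h1
      linarith
    linarith)
  simpa using this

/-- The stream that consists of `M` phases followed by a burst of unit jobs from time `T` on.
In each phase a long job and `N * n` short jobs are released. -/
noncomputable def phases (N n M : ℕ) (T : ℝ) (hn : 1 ≤ n) (hT0 : 0 ≤ T)
    (hT : ∀ i < M, phaseStart n i ≤ T) : JobStream where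
  r q := if q < M * (N * n + 1) then phaseStart n (q / (N * n + 1))
    else T + (((q - M * (N * n + 1)) / N : ℕ) : ℝ)
  p q := if q < M * (N * n + 1) then
      (if q % (N * n + 1) = 0 then phaseLen n (q / (N * n + 1))
        else shortLen n (q / (N * n + 1)))
    else 1
  r_nonneg q := by
    split_ifs
    · exact phaseStart_nonneg _ _
    · positivity
  p_pos q := by
    split_ifs
    · exact phaseLen_pos hn _
    · exact shortLen_pos _ _
    · exact one_pos
  mono q q' h := by
    dsimp only
    split_ifs with h1 h2 h2
    · exact phaseStart_mono n (Nat.div_le_div_right h)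
    · have : (0 : ℝ) ≤ (((q' - M * (N * n + 1)) / N : ℕ) : ℝ) := by positivity
      have := hT (q / (N * n + 1)) ((Nat.div_lt_iff_lt_mul (by omega)).2 h1)
      linarith
    · omega
    · have : (q - M * (N * n + 1)) / N ≤ (q' - M * (N * n + 1)) / N :=
        Nat.div_le_div_right (by omega)
      have : (((q - M * (N * n + 1)) / N : ℕ) : ℝ) ≤ (((q' - M * (N * n + 1)) / N : ℕ) : ℝ) := by
        exact_mod_cast this
      linarith

section Phases

variable {n M : ℕ} {T : ℝ} {hn : 1 ≤ n} {hT0 : 0 ≤ T} {hT : ∀ i < M, phaseStart n i ≤ T}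

/-- Job `j` of phase `i` has index `i * W + j` with `W = N * n + 1`; `j = 0` is the long job. -/
theorem phase_index_lt {W i j : ℕ} (hi : i < M) (hj : j < W) : i * W + j < M * W := by
  calc i * W + j < i * W + W := by omega
    _ = (i + 1) * W := by ring
    _ ≤ M * W := Nat.mul_le_mul_right _ hi

theorem phases_r_of_lt {q : ℕ} (hq : q < M * (N * n + 1)) :
    (phases N n M T hn hT0 hT).r q = phaseStart n (q / (N * n + 1)) := by
  simp [phases, hq]

theorem phases_p_of_lt {q : ℕ} (hq : q < M * (N * n + 1)) :
    (phases N n M T hn hT0 hT).p q = if q % (N * n + 1) = 0 then phaseLen n (q / (N * n + 1))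
        else shortLen n (q / (N * n + 1)) := by
  simp [phases, hq]

theorem phases_r_add (j : ℕ) : (phases N n M T hn hT0 hT).r (M * (N * n + 1) + j)
    = T + ((j / N : ℕ) : ℝ) := by
  simp [phases]

theorem phases_p_add (j : ℕ) : (phases N n M T hn hT0 hT).p (M * (N * n + 1) + j) = 1 := by
  simp [phases]

theorem phases_r_index {i j : ℕ} (hi : i < M) (hj : j < N * n + 1) :
    (phases N n M T hn hT0 hT).r (i * (N * n + 1) + j) = phaseStart n i := by
  rw [phases_r_of_lt (phase_index_lt hi hj), add_comm, Nat.add_mul_div_right _ _ (by omega),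
    Nat.div_eq_of_lt hj, zero_add]

theorem phases_p_long {i : ℕ} (hi : i < M) :
    (phases N n M T hn hT0 hT).p (i * (N * n + 1)) = phaseLen n i := by
  rw [phases_p_of_lt (by simpa using phase_index_lt (j := 0) hi (Nat.succ_pos (N * n)))]
  simp

theorem phases_p_short {i j : ℕ} (hi : i < M) (hj : j < N * n) :
    (phases N n M T hn hT0 hT).p (i * (N * n + 1) + (1 + j)) = shortLen n i := by
  have h1 : (i * (N * n + 1) + (1 + j)) / (N * n + 1) = i := by
    rw [add_comm, Nat.add_mul_div_right _ _ (by omega), Nat.div_eq_of_lt (by omega), zero_add]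
  have h2 : (i * (N * n + 1) + (1 + j)) % (N * n + 1) = 1 + j := by
    rw [Nat.mul_add_mod_self_right, Nat.mod_eq_of_lt (by omega)]
  rw [phases_p_of_lt (phase_index_lt hi (by omega)), h1, h2, if_neg (by omega)]

theorem one_le_phases_p (hM : M ≤ n) (q : ℕ) : 1 ≤ (phases N n M T hn hT0 hT).p q := by
  simp only [phases]
  split_ifs with h1 h2
  all_goals try exact le_rfl
  all_goals
    have hi : q / (N * n + 1) < M := (Nat.div_lt_iff_lt_mul (by omega)).2 h1
    have := one_le_shortLen (hi.le.trans hM)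
  · exact this.trans (shortLen_le_phaseLen hn _)
  · exact this

theorem phases_p_le (q : ℕ) : (phases N n M T hn hT0 hT).p q ≤ phaseLen n 0 := by
  simp only [phases]
  split_ifs with h1 h2
  · exact phaseLen_antitone n (Nat.zero_le _)
  · exact (shortLen_le_phaseLen hn _).trans (phaseLen_antitone n (Nat.zero_le _))
  · exact (one_le_shortLen (Nat.zero_le n)).trans (shortLen_le_phaseLen hn 0)

theorem phases_alpha (hM : M ≤ n) (hM1 : 1 ≤ M) {K : ℕ} (hK : 1 ≤ K)
    {h : 0 < M * (N * n + 1) + K} :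
    ((phases N n M T hn hT0 hT).input np (M * (N * n + 1) + K) h).alpha = phaseLen n 0 := by
  have h0 : (phases N n M T hn hT0 hT).p 0 = phaseLen n 0 := by
    simpa using phases_p_long (N := N) (hn := hn) (hT0 := hT0) (hT := hT) hM1
  have h1 := phases_p_add (N := N) (hn := hn) (hT0 := hT0) (hT := hT) 0
  rw [Input.alpha, pmax_input 0 h (fun i _ => h0 ▸ phases_p_le i),
    pmin_input (M * (N * n + 1) + 0) (by omega) (fun i _ => h1 ▸ one_le_phases_p hM i), h0, h1,
    div_one]

end Phases


/-! ### The offline plan for the phases -/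

/-- The machine of the `j`-th job of the `i`-th phase in the offline plan: in the phase `c` all
machines are used for the short jobs, in the other ones machine `0` is reserved for the long
job. -/
def phaseMach (n c i j : ℕ) : ℕ :=
  if j = 0 then 0 else if i = c then (j - 1) / n else 1 + (j - 1) / (2 * n)

/-- The starting time of the `j`-th job of the `i`-th phase in the offline plan: the long job of
the phase `c` is postponed to the time `E`. -/
noncomputable def phasePlan (n c : ℕ) (E : ℝ) (i j : ℕ) : ℝ :=
  if j = 0 then (if i = c then E else phaseStart n i)
  else if i = c then phaseStart n i + ((j - 1) % n : ℕ) * shortLen n i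
  else phaseStart n i + ((j - 1) % (2 * n) : ℕ) * shortLen n i

/-- The time at which the offline plan has finished the `i`-th phase, up to the postponed job. -/
noncomputable def phaseEnd (n c i : ℕ) : ℝ :=
  phaseStart n i + (if i = c then phaseLen n i / 2 else phaseLen n i)

theorem phaseEnd_le (n c i : ℕ) : phaseEnd n c i ≤ phaseStart n (i + 1) := by
  rw [phaseEnd, phaseStart_succ]
  have := phaseLen_nonneg n i
  split_ifs <;> linarith

theorem phaseStart_le_phasePlan {n c : ℕ} {E : ℝ} {i j : ℕ}
    (hE : i = c → phaseStart n i ≤ E) : phaseStart n i ≤ phasePlan n c E i j := by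
  unfold phasePlan
  have := shortLen_pos n i
  split_ifs with h1 h2 h2
  · exact hE h2
  · exact le_rfl
  · have : 0 ≤ (((j - 1) % n : ℕ) : ℝ) * shortLen n i := by positivity
    linarith
  · have : 0 ≤ (((j - 1) % (2 * n) : ℕ) : ℝ) * shortLen n i := by positivity
    linarith

/-- In phase `c` the `n` slots per machine fill half of the phase; in the others the `2n` slots fill
all of it. -/
theorem phasePlan_add_le {n c : ℕ} (hn : 1 ≤ n) {E : ℝ} {i j : ℕ} (hij : ¬ (i = c ∧ j = 0)) :
    phasePlan n c E i j + (if j = 0 then phaseLen n i else shortLen n i) ≤ phaseEnd n c i := by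
  have hs := shortLen_pos n i
  have key : ∀ m : ℕ, 1 ≤ m →
      (((j - 1) % m : ℕ) : ℝ) * shortLen n i + shortLen n i ≤ m * shortLen n i := by
    intro m hm
    have : (j - 1) % m + 1 ≤ m := Nat.mod_lt _ hm
    have : (((j - 1) % m : ℕ) : ℝ) + 1 ≤ m := by exact_mod_cast this
    nlinarith
  unfold phasePlan phaseEnd
  by_cases h1 : j = 0 <;> by_cases h2 : i = c
  · exact absurd ⟨h2, h1⟩ hij
  · simp [h1, h2]
  · simp only [if_neg h1, if_pos h2]
    have := key n hn
    unfold phaseLen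
    linarith
  · simp only [if_neg h1, if_neg h2]
    have := key (2 * n) (by omega)
    push_cast at this
    unfold phaseLen
    linarith

/-- Short jobs with the same quotient have different remainders, hence different slots. The long job
either has machine 0 to itself or waits until the short jobs are done. -/
theorem phasePlan_disjoint {n c : ℕ} (hn : 1 ≤ n) {E : ℝ} {i j j' : ℕ} (hjj : j < j')
    (hE : i = c → phaseEnd n c i ≤ E) (hm : phaseMach n c i j = phaseMach n c i j') :
    phasePlan n c E i j + (if j = 0 then phaseLen n i else shortLen n i) ≤ phasePlan n c E i j' ∨
    phasePlan n c E i j' + (if j' = 0 then phaseLen n i else shortLen n i)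
      ≤ phasePlan n c E i j := by
  have hj' : j' ≠ 0 := by omega
  rcases Nat.eq_zero_or_pos j with rfl | hj
  · by_cases h : i = c
    · right
      have := phasePlan_add_le hn (n := n) (c := c) (E := E) (i := i) (j := j') (by tauto)
      refine this.trans ((hE h).trans ?_)
      simp [phasePlan, h]
    · exfalso
      rw [phaseMach, phaseMach, if_pos rfl, if_neg hj', if_neg h] at hm
      generalize (j' - 1) / (2 * n) = x at hm
      omega
  · have hj0 : j ≠ 0 := by omega
    have hne : ∀ m, (j - 1) / m = (j' - 1) / m → (j - 1) % m ≠ (j' - 1) % m := by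
      intro m h1 h2
      have := Nat.div_add_mod (j - 1) m
      have := Nat.div_add_mod (j' - 1) m
      rw [h1, h2] at *
      omega
    have hs := (shortLen_pos n i).le
    by_cases h : i = c
    · simp only [phaseMach, phasePlan, if_neg hj', if_neg hj0, if_pos h] at hm ⊢
      exact slots_disjoint (hne _ hm) _ hs
    · simp only [phaseMach, phasePlan, if_neg hj', if_neg hj0, if_neg h] at hm ⊢
      exact slots_disjoint (hne _ (by omega)) _ hs

/-- Here two machines are needed: `N - 1` machines with `2n` slots each hold `N n` short jobs
because `N ≤ 2 (N - 1)`. -/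
theorem phaseMach_lt {n c i j : ℕ} (hn : 1 ≤ n) (hN : 2 ≤ N) (hj : j < N * n + 1) :
    phaseMach n c i j < N := by
  unfold phaseMach
  split_ifs with h1 h2
  · omega
  · exact Nat.div_lt_of_lt_mul (by rw [mul_comm]; omega)
  · have : (j - 1) / (2 * n) < N - 1 := by
      refine Nat.div_lt_of_lt_mul ?_
      obtain ⟨a, rfl⟩ := Nat.exists_eq_add_of_le hN
      have : 2 * n * (2 + a - 1) = (2 + a) * n + a * n := by
        rw [show 2 + a - 1 = 1 + a by omega]; ring
      rw [this]
      have : j - 1 < (2 + a) * n := by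
        have : 0 < (2 + a) * n := by positivity
        omega
      omega
    omega

/-- An upper bound on the optimal cost of a sequence of phases with a burst.  Only the long job of
the phase `c`, if there is such a phase, is run after the burst. -/
theorem opt_phases_le {n M : ℕ} {T : ℝ} {hn : 1 ≤ n} {hT0 : 0 ≤ T}
    {hT : ∀ i < M, phaseStart n i ≤ T} (hN : 2 ≤ N) (c D : ℕ) (hc : M ≤ c + 1)
    (hcT : ∀ i < M, phaseEnd n c i ≤ T) (hcT' : c < M → T ≤ phaseStart n c + phaseLen n 0)
    {h : 0 < M * (N * n + 1) + N * D} :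
    opt N ((phases N n M T hn hT0 hT).input np (M * (N * n + 1) + N * D) h)
      ≤ M * (N * n + 1) * phaseLen n 0 + (D + 2 * phaseLen n 0) + N * D := by
  set S := phases N n M T hn hT0 hT with hS
  set W := N * n + 1 with hW
  have hW0 : 0 < W := by omega
  have hN0 : 0 < N := by omega
  have hP := phaseLen_nonneg n 0
  have hD0 : (0 : ℝ) ≤ D := by positivity
  have hr : ∀ q < M * W, S.r q = phaseStart n (q / W) := fun q hq => phases_r_of_lt hq
  have hp : ∀ q < M * W, S.p q = if q % W = 0 then phaseLen n (q / W) else shortLen n (q / W) :=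
    fun q hq => phases_p_of_lt hq
  have hbr : ∀ j, S.r (M * W + j) = T + ((j / N : ℕ) : ℝ) := phases_r_add
  have hbp : ∀ j, S.p (M * W + j) = 1 := phases_p_add
  have hdiv : ∀ q < M * W, q / W < M := fun q hq => (Nat.div_lt_iff_lt_mul hW0).2 hq
  set st : ℕ → ℝ := fun q => if q < M * W then phasePlan n c (T + D) (q / W) (q % W) else S.r q
    with hst
  set mach : ℕ → Fin N := fun q =>
    if h : q < M * W then ⟨phaseMach n c (q / W) (q % W), phaseMach_lt hn hN (Nat.mod_lt _ hW0)⟩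
    else ⟨(q - M * W) % N, Nat.mod_lt _ hN0⟩ with hmach
  have hst1 : ∀ q < M * W, st q = phasePlan n c (T + D) (q / W) (q % W) := fun q hq => if_pos hq
  have hst2 : ∀ j, st (M * W + j) = T + ((j / N : ℕ) : ℝ) := fun j => by
    rw [← hbr]; exact if_neg (by omega)
  have hm1 : ∀ q < M * W, (mach q : ℕ) = phaseMach n c (q / W) (q % W) := fun q hq => by
    simp [hmach, hq]
  have hm2 : ∀ j, (mach (M * W + j) : ℕ) = j % N := fun j => by simp [hmach]
  have hwin : ∀ q < M * W, ¬ (q / W = c ∧ q % W = 0) → st q + S.p q ≤ phaseEnd n c (q / W) :=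
    fun q hq hqc => by
      rw [hst1 q hq, hp q hq]
      exact phasePlan_add_le hn hqc
  have hpost : ∀ q < M * W, q / W = c → q % W = 0 → st q = T + D := fun q hq h1 h2 => by
    rw [hst1 q hq, phasePlan, if_pos h2, if_pos h1]
  have hlow : ∀ q < M * W, phaseStart n (q / W) ≤ st q := fun q hq => by
    rw [hst1 q hq]
    exact phaseStart_le_phasePlan fun _ => by linarith [hT _ (hdiv q hq)]
  refine (opt_le_of_plan (S := S) (np := np) (hn := h) mach st ?_ ?_).trans ?_
  · intro q _
    by_cases hq : q < M * W
    · rw [hr q hq]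
      exact hlow q hq
    · exact (if_neg hq).ge
  · intro q q' hqq hq' hm
    have hm : (mach q : ℕ) = mach q' := by rw [hm]
    by_cases hq'M : q' < M * W
    · have hqM : q < M * W := hqq.trans hq'M
      rcases (Nat.div_le_div_right hqq.le : q / W ≤ q' / W).eq_or_lt with hi | hi
      · have hjj : q % W < q' % W := by
          have h1 := Nat.div_add_mod q W
          have h2 := Nat.div_add_mod q' W
          rw [← hi] at h2
          omega
        rw [hm1 q hqM, hm1 q' hq'M, ← hi] at hm
        rw [hst1 q hqM, hst1 q' hq'M, hp q hqM, hp q' hq'M, ← hi]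
        exact phasePlan_disjoint hn hjj (fun _ => by linarith [hcT _ (hdiv q hqM)]) hm
      · left
        have hi' := hdiv q' hq'M
        refine (hwin q hqM (by omega)).trans ((phaseEnd_le n c _).trans ?_)
        exact (phaseStart_mono n hi).trans (hlow q' hq'M)
    · obtain ⟨j', rfl⟩ := Nat.exists_eq_add_of_le (not_lt.1 hq'M)
      have hj' : j' / N + 1 ≤ D := Nat.div_lt_of_lt_mul (by omega)
      have hj'' : ((j' / N : ℕ) : ℝ) + 1 ≤ D := by exact_mod_cast hj'
      have hj0 : (0 : ℝ) ≤ ((j' / N : ℕ) : ℝ) := by positivity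
      rw [hst2, hbp]
      by_cases hqM : q < M * W
      · by_cases hqc : q / W = c ∧ q % W = 0
        · right
          rw [hpost q hqM hqc.1 hqc.2]
          linarith
        · left
          linarith [hwin q hqM hqc, hcT _ (hdiv q hqM)]
      · obtain ⟨j, rfl⟩ := Nat.exists_eq_add_of_le (not_lt.1 hqM)
        left
        rw [hm2, hm2] at hm
        rw [hst2, hbp]
        have h1 : j / N ≤ j' / N := Nat.div_le_div_right (by omega)
        have h2 : j / N ≠ j' / N := by
          intro h
          have := Nat.div_add_mod j N
          have := Nat.div_add_mod j' N
          rw [h, hm] at *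
          omega
        have h3 : j / N + 1 ≤ j' / N := by omega
        have h4 : ((j / N : ℕ) : ℝ) + 1 ≤ ((j' / N : ℕ) : ℝ) := by exact_mod_cast h3
        linarith
  · rw [Finset.sum_range_add]
    refine add_le_add ?_ (le_of_eq ?_)
    -- Every job finishes within its own phase, except the postponed one, which ends at `T + D +
    -- phaseLen n c`, where `T` is at most `phaseLen n 0` after its release.
    · have hb : ∀ q ∈ Finset.range (M * W), st q + S.p q - S.r q
          ≤ phaseLen n 0 + if q = c * W then D + 2 * phaseLen n 0 else 0 := by
        intro q hq
        have hq := Finset.mem_range.1 hq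
        have hL : phaseLen n (q / W) ≤ phaseLen n 0 := phaseLen_antitone n (Nat.zero_le _)
        rw [hr q hq]
        by_cases hqc : q / W = c ∧ q % W = 0
        · have hqW : q = c * W := by
            have := Nat.div_add_mod q W
            rw [hqc.1, hqc.2] at this
            rw [← this]; ring
          rw [if_pos hqW, hpost q hq hqc.1 hqc.2, hp q hq, if_pos hqc.2, hqc.1]
          have hd := hdiv q hq
          rw [hqc.1] at hL hd
          linarith [hcT' hd]
        · have h1 := hwin q hq hqc
          have h2 := phaseEnd_le n c (q / W)
          rw [phaseStart_succ] at h2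
          have h3 : 0 ≤ if q = c * W then D + 2 * phaseLen n 0 else 0 := by
            split_ifs <;> positivity
          linarith
      refine (Finset.sum_le_sum hb).trans ?_
      rw [Finset.sum_add_distrib, Finset.sum_ite_eq', Finset.sum_const, Finset.card_range,
        nsmul_eq_mul]
      have : (if c * W ∈ Finset.range (M * W) then (D : ℝ) + 2 * phaseLen n 0 else 0)
          ≤ D + 2 * phaseLen n 0 := by
        split_ifs
        · exact le_rfl
        · positivity
      push_cast [hW]
      linarith
    · rw [Finset.sum_congr rfl (g := fun _ => (1 : ℝ)) fun j _ => by rw [hst2, hbp, hbr]; ring]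
      simp

end JobStream

/-! ### The lower bound for preemptive tasks -/

/-- The instance that consists of `M` phases and a long burst that starts at time `T`. -/
noncomputable def phaseInput (N n M : ℕ) (T : ℝ) (hn : 1 ≤ n) (hM : 1 ≤ M) (hT0 : 0 ≤ T)
    (hT : ∀ i < M, phaseStart n i ≤ T) : Input :=
  (phases N n M T hn hT0 hT).input false
    (M * (N * n + 1) + N * (n ^ 2 * (2 * n * 9 ^ n))) (by positivity)

theorem opt_phaseInput_le {N n M : ℕ} {T : ℝ} {hn : 1 ≤ n} {hM : 1 ≤ M} {hT0 : 0 ≤ T}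
    {hT : ∀ i < M, phaseStart n i ≤ T} (hN : 2 ≤ N) (hMn : M ≤ n) (c : ℕ) (hc : M ≤ c + 1)
    (hcT : ∀ i < M, phaseEnd n c i ≤ T) (hcT' : c < M → T ≤ phaseStart n c + phaseLen n 0) :
    opt N (phaseInput N n M T hn hM hT0 hT)
      ≤ (2 * N + 4) * ((n ^ 2 * (2 * n * 9 ^ n) : ℕ) : ℝ) := by
  refine (opt_phases_le hN c _ hc hcT hcT').trans ?_
  rw [Nat.cast_mul (n ^ 2), ← phaseLen_zero, Nat.cast_pow]
  have hP := phaseLen_nonneg n 0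
  have hn1 : (1 : ℝ) ≤ n := by exact_mod_cast hn
  have hM1 : (M : ℝ) ≤ n := by exact_mod_cast hMn
  have hN0 : (0 : ℝ) ≤ N := by positivity
  have h1 : (M : ℝ) * (N * n + 1) ≤ (N + 1) * n ^ 2 := by
    calc (M : ℝ) * (N * n + 1) ≤ n * (N * n + 1) := by gcongr
      _ ≤ (N + 1) * n ^ 2 := by nlinarith
  have h2 : (1 : ℝ) ≤ n ^ 2 := one_le_pow₀ hn1
  have h3 := mul_le_mul_of_nonneg_right h1 hP
  have h4 := mul_le_mul_of_nonneg_right h2 hP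
  linarith

/-- For single preemptive tasks, every online algorithm is beaten by a factor of order `n` on one
of the instances with at most `n` phases. -/
theorem exists_preemptive_hard {N : ℕ} (hN : 2 ≤ N) (A : OnlineAlgorithm N) (n : ℕ)
    (hn : 1 ≤ n) :
    ∃ ω ∈ singleTask false, ω.alpha = phaseLen n 0 ∧ 0 < opt N ω ∧
      n * opt N ω ≤ 8 * (2 * N + 4) * cost ω (A.run ω) := by
  have hN1 : 1 ≤ N := by omega
  set D := n ^ 2 * (2 * n * 9 ^ n) with hD
  have hD1 : 0 < D := by positivity
  have hND : 1 ≤ N * D := Nat.mul_pos hN1 hD1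
  set W := N * n + 1 with hW
  suffices H : ∃ (M : ℕ) (T : ℝ) (hM : 1 ≤ M) (hT0 : 0 ≤ T) (hT : ∀ i < M, phaseStart n i ≤ T)
      (c : ℕ), M ≤ n ∧ M ≤ c + 1 ∧ (∀ i < M, phaseEnd n c i ≤ T) ∧
        (c < M → T ≤ phaseStart n c + phaseLen n 0) ∧
        (n : ℝ) / 8 ≤ ∑ q ∈ Finset.range (M * W),
          (1 - (A.run (phaseInput N n M T hn hM hT0 hT)).work q T
            / (phases N n M T hn hT0 hT).p q) by
    obtain ⟨M, T, hM, hT0, hT, c, hMn, hc, hcT, hcT', hΦ⟩ := H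
    have hF := A.feasible (phaseInput N n M T hn hM hT0 hT)
    refine ⟨phaseInput N n M T hn hM hT0 hT, input_mem_singleTask, phases_alpha hMn hM hND,
      opt_pos hF, ?_⟩
    have h1 := opt_phaseInput_le (hn := hn) (hM := hM) (hT0 := hT0) (hT := hT) hN hMn c hc hcT hcT'
    have h2 := mul_le_cost_of_burst hN1 hF
      (fun q hq => by
        rw [phases_r_of_lt hq]
        exact hT _ ((Nat.div_lt_iff_lt_mul (by omega)).2 hq))
      (fun q _ => one_le_phases_p hMn q) phases_r_add phases_p_add (by positivity) hΦ
    rw [← hD] at h1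
    calc n * opt N (phaseInput N n M T hn hM hT0 hT)
        ≤ n * ((2 * N + 4) * (D : ℝ)) := mul_le_mul_of_nonneg_left h1 (by positivity)
      _ = 8 * (2 * N + 4) * (n / 8 * D) := by ring
      _ ≤ _ := mul_le_mul_of_nonneg_left h2 (by positivity)
  have hT : ∀ i < n, phaseStart n i ≤ phaseStart n n := fun i hi => phaseStart_mono n hi.le
  have hT0 := phaseStart_nonneg n n
  set S := phases N n n (phaseStart n n) hn hT0 hT with hS
  set ω := phaseInput N n n (phaseStart n n) hn hn hT0 hT with hω
  have hF : Feasible (S.input false _ _) (A.run ω) := A.feasible ω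
  -- The adversary watches the run on the full `n`-phase instance and stops at the first half of a
  -- phase in which the short jobs were neglected.
  by_cases hmid : ∃ i < n, ∑ j ∈ Finset.range (N * n),
      (A.run ω).work (i * W + (1 + j)) (phaseStart n i + phaseLen n i / 2)
        ≤ N * n * shortLen n i - n / 2 * shortLen n i
  · obtain ⟨i, hi, hsum⟩ := hmid
    set T := phaseStart n i + phaseLen n i / 2 with hTdef
    have hL := phaseLen_nonneg n i
    have hT1 : ∀ i' < i + 1, phaseStart n i' ≤ T := fun i' hi' => by
      linarith [phaseStart_mono n (Nat.le_of_lt_succ hi')]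
    have hT01 : 0 ≤ T := (phaseStart_nonneg n i).trans (hT1 i (by omega))
    refine ⟨i + 1, T, by omega, hT01, hT1, i, hi, le_rfl, ?_, ?_, ?_⟩
    · intro i' hi'
      rcases (Nat.le_of_lt_succ hi').eq_or_lt with rfl | h
      · simp [phaseEnd, hTdef]
      · exact (phaseEnd_le n i i').trans ((phaseStart_mono n h).trans (hT1 i (by omega)))
    · intro _
      linarith [phaseLen_antitone n (Nat.zero_le i)]
    · set S' := phases N n (i + 1) T hn hT01 hT1 with hS'
      set ω' := phaseInput N n (i + 1) T hn (by omega) hT01 hT1 with hω'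
      have hF' : Feasible (S'.input false _ _) (A.run ω') := A.feasible ω'
      have hTi : T ≤ phaseStart n (i + 1) := by rw [phaseStart_succ]; linarith
      have hle : (i + 1) * W ≤ n * W := Nat.mul_le_mul_right _ hi
      have hagree : ∀ t < T, ∀ m, A.run ω m t = A.run ω' m t := by
        intro t ht
        refine A.causal _ _ t (revealed_input_eq ((i + 1) * W) t
          (hle.trans (Nat.le_add_right _ _)) (Nat.le_add_right _ _) ?_ ?_ ?_ ?_)
        · intro q hq
          rw [phases_r_of_lt hq, phases_r_of_lt (hq.trans_le hle)]
        · intro q hq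
          rw [phases_p_of_lt hq, phases_p_of_lt (hq.trans_le hle)]
        · intro q hq _
          have h1 : S.r ((i + 1) * W) ≤ S.r q := S.mono hq
          have h2 : phaseStart n (i + 1) ≤ S.r ((i + 1) * W) := by
            -- After the last phase, the next job of the full instance is the first one of its
            -- burst, released at `phaseStart n n`.
            rcases (show i + 1 ≤ n from hi).eq_or_lt with h | h
            · have := phases_r_add (N := N) (hn := hn) (hT0 := hT0) (hT := hT) 0
              rw [h]
              simpa using this.ge
            · have := phases_r_index (N := N) (hn := hn) (hT0 := hT0) (hT := hT) (j := 0) h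
                (by omega)
              simpa using this.ge
          linarith
        · intro q hq _
          have h1 : S'.r ((i + 1) * W + 0) ≤ S'.r q := S'.mono hq
          rw [phases_r_add] at h1
          simp only [Nat.zero_div, Nat.cast_zero, add_zero] at h1
          linarith
      have hs := shortLen_pos n i
      have hnonneg : ∀ q < (i + 1) * W, 0 ≤ 1 - (A.run ω').work q T / S'.p q := fun q hq =>
        sub_nonneg.2 ((div_le_one (S'.p_pos q)).2 
          (work_le hF' (hq.trans_le (Nat.le_add_right _ _)) T))
      refine le_trans ?_ (sum_range_comp_le (a := N * n) (g := fun j => i * W + (1 + j)) hnonneg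
        (fun a b h => by simpa using h) (fun j hj => phase_index_lt (by omega) (by omega)))
      have heq : ∀ j ∈ Finset.range (N * n),
          1 - (A.run ω').work (i * W + (1 + j)) T / S'.p (i * W + (1 + j))
            = 1 - (A.run ω).work (i * W + (1 + j)) T / shortLen n i := fun j hj => by
        rw [phases_p_short (by omega) (Finset.mem_range.1 hj),
          work_eq_of_agree hagree _ le_rfl]
      rw [Finset.sum_congr rfl heq, Finset.sum_sub_distrib, ← Finset.sum_div]
      have : (∑ j ∈ Finset.range (N * n), (A.run ω).work (i * W + (1 + j)) T) / shortLen n i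
          ≤ N * n - n / 2 := by
        rw [div_le_iff₀ hs]
        linarith
      have hn0 : (0 : ℝ) ≤ n := by positivity
      simp only [Finset.sum_const, Finset.card_range, nsmul_eq_mul, mul_one, Nat.cast_mul]
      linarith
  · push Not at hmid
    -- Taking `c = n` means that no long job is postponed.
    refine ⟨n, phaseStart n n, hn, hT0, hT, n, le_rfl, by omega, ?_, fun h => by omega, ?_⟩
    · intro i hi
      exact (phaseEnd_le n n i).trans (phaseStart_mono n hi)
    · have hnonneg : ∀ q < n * W, 0 ≤ 1 - (A.run ω).work q (phaseStart n n) / S.p q :=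
        fun q hq => sub_nonneg.2 ((div_le_one (S.p_pos q)).2 
          (work_le hF (hq.trans_le (Nat.le_add_right _ _)) _))
      refine le_trans ?_ (sum_range_comp_le (a := n) (g := fun i => i * W) hnonneg
        (fun a b h => Nat.eq_of_mul_eq_mul_right (by omega) h)
        (fun i hi => Nat.mul_lt_mul_of_pos_right hi (by omega)))
      have hlong : ∀ i ∈ Finset.range n,
          (1 : ℝ) / 8 ≤ 1 - (A.run ω).work (i * W) (phaseStart n n) / S.p (i * W) := by
        intro i hi
        have hi := Finset.mem_range.1 hi
        have hL := phaseLen_pos hn i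
        have hsum := hmid i hi
        have hle : phaseStart n i ≤ phaseStart n i + phaseLen n i / 2 := by linarith
        have hz : ∀ j < W, (A.run ω).work (i * W + j) (phaseStart n i) = 0 := fun j hj =>
          work_eq_zero hF (phases_r_index hi hj).ge
        -- Half a phase offers capacity `N n s_i`, of which the short jobs took more than `N n s_i -
        -- n s_i / 2`; at most `n s_i / 2 = L_i / 4` is left for the long job.
        have hcap := sum_work_sub_le hF ((Finset.range W).image fun j => i * W + j) hle
        rw [Finset.sum_image (fun a _ b _ h => by simpa using h),
          Finset.sum_congr rfl fun j hj => by rw [hz j (Finset.mem_range.1 hj), sub_zero], hW,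
          add_comm (N * n) 1, Finset.sum_range_add, Finset.sum_range_one] at hcap
        rw [add_comm 1 (N * n), ← hW, add_zero] at hcap
        have hphase : phaseLen n i = 2 * n * shortLen n i := rfl
        have h1 : (A.run ω).work (i * W) (phaseStart n i + phaseLen n i / 2)
            ≤ phaseLen n i / 4 := by
          rw [hphase] at hcap hsum ⊢
          linarith
        have h2 : phaseStart n i + phaseLen n i / 2 ≤ phaseStart n n := by
          have := phaseStart_mono n (show i + 1 ≤ n from hi)
          rw [phaseStart_succ] at this
          linarith
        have h3 := work_sub_le hF (i * W) h2
        have h4 := phaseStart_sub_le n i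
        rw [phaseStart_succ] at h4
        -- `7 / 8 = 1 / 4 + 1 / 2 + 1 / 8`: first half of the phase, second half, all later phases.
        have h5 : (A.run ω).work (i * W) (phaseStart n n) / phaseLen n i ≤ 7 / 8 := by
          rw [div_le_iff₀ hL]
          linarith
        rw [phases_p_long hi]
        linarith
      calc (n : ℝ) / 8 = ∑ _i ∈ Finset.range n, (1 : ℝ) / 8 := by simp; ring
        _ ≤ _ := Finset.sum_le_sum hlong

theorem log_phaseLen_le {n : ℕ} (hn : 1 ≤ n) : Real.log (phaseLen n 0) ≤ 10 * n := by
  have hn1 : (1 : ℝ) ≤ n := by exact_mod_cast hn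
  have h9 : Real.log 9 ≤ 8 := by
    have := Real.log_le_sub_one_of_pos (show (0 : ℝ) < 9 by norm_num)
    linarith
  have h2 : Real.log (2 * n) ≤ 2 * n := Real.log_le_self (by positivity)
  rw [phaseLen_zero]
  push_cast
  rw [Real.log_mul (by positivity) (by positivity), Real.log_pow]
  nlinarith

theorem le_log_phaseLen {n : ℕ} (hn : 1 ≤ n) : (n : ℝ) ≤ Real.log (phaseLen n 0) := by
  have hn1 : (1 : ℝ) ≤ n := by exact_mod_cast hn
  rw [Real.le_log_iff_exp_le (phaseLen_pos hn 0), phaseLen_zero]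
  push_cast
  have h1 : Real.exp n ≤ 9 ^ n := by
    rw [← Real.exp_one_pow]
    have := Real.exp_one_lt_d9
    exact pow_le_pow_left₀ (Real.exp_pos 1).le (by linarith) n
  have h2 : (0 : ℝ) < 9 ^ n := by positivity
  nlinarith

/-- On at least two machines, no online algorithm has competitive ratio `o(ln α)` on single
preemptive tasks. -/
theorem not_ratioLittleO_log {N : ℕ} (hN : 2 ≤ N) (A : OnlineAlgorithm N) :
    ¬ RatioLittleO A (singleTask false) (fun a _ => Real.log a) := by
  intro h
  set C : ℝ := 8 * (2 * N + 4) with hC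
  have hC0 : 0 < C := by positivity
  -- Since `ln α ≤ 10 n`, the factor 20 leaves half of the lower bound `n * opt`, a contradiction.
  obtain ⟨M, hM⟩ := h (1 / (20 * C)) (by positivity)
  obtain ⟨n, hn⟩ := exists_nat_ge (max M 1)
  have hn1 : (1 : ℝ) ≤ n := (le_max_right _ _).trans hn
  have hn1' : 1 ≤ n := by exact_mod_cast hn1
  obtain ⟨ω, hω, ha, ho, hcost⟩ := exists_preemptive_hard hN A n hn1'
  have hlog := le_log_phaseLen hn1'
  have hlog0 : 0 ≤ Real.log (phaseLen n 0) := by linarith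
  have h1 := cost_le_of_ratio
    (hM (phaseLen n 0) ω.beta (((le_max_left M 1).trans hn).trans hlog))
    ⟨hω, ha, rfl⟩ (by positivity) ho
  have h2 : C * cost ω (A.run ω) ≤ n * opt N ω / 2 := by
    calc C * cost ω (A.run ω)
        ≤ C * (1 / (20 * C) * Real.log (phaseLen n 0) * opt N ω) :=
          mul_le_mul_of_nonneg_left h1 hC0.le
      _ = Real.log (phaseLen n 0) * opt N ω / 20 := by field_simp
      _ ≤ 10 * n * opt N ω / 20 := by
          have := mul_le_mul_of_nonneg_right (log_phaseLen_le hn1') ho.le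
          linarith
      _ = n * opt N ω / 2 := by ring
  have h3 : 0 < n * opt N ω := by positivity
  linarith

end MPMS

theorem mainTheorem2 (N : ℕ) (hN : 1 ≤ N) :
    (¬ ∃ A : MPMS.OnlineAlgorithm N,
      MPMS.RatioLittleO A Set.univ (fun α β => Real.log α + β)) ∧
    (2 ≤ N → ¬ ∃ A : MPMS.OnlineAlgorithm N,
      MPMS.RatioLittleO A (MPMS.singleTask false) (fun α _ => Real.log α)) ∧
    (¬ ∃ A : MPMS.OnlineAlgorithm N,
      MPMS.RatioLittleO A (MPMS.singleTask true) (fun _ β => β)) := by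
  refine ⟨?_, fun hN2 => ?_, ?_⟩
  · rintro ⟨A, hA⟩
    exact MPMS.not_ratioLittleO_log_add_beta hN A hA
  · rintro ⟨A, hA⟩
    exact MPMS.not_ratioLittleO_log hN2 A hA
  · rintro ⟨A, hA⟩
    exact MPMS.not_ratioLittleO_beta hN A hA
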